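/- Let $W$ be a compact metric space, $S$ a countable set and $E=W^S$ with the product topology (a compact metrizable space). For every finite $\Lambda\subseteq S$ and $\eta\in E$ let $c_\Lambda(\eta,d\zeta)$ be a finite Borel measure on $W^\Lambda$, depending weakly continuously on $\eta$. Put $c_\Lambda=\sup_\eta c_\Lambda(\eta,W^\Lambda)$ and $$c_\Lambda(u)=\sup\{\|c_\Lambda(\eta,\cdot)-c_\Lambda(\hat\eta,\cdot)\|_{TV} : \eta_y=\hat\eta_y \text{ for all } y\neq u\},$$ and assume $$\sup_{x\in S}\sum_{\Lambda\ni x}c_\Lambda<\infty ,\qquad \sup_{x\in S}\sum_{\Lambda\ni x}\sum_{u\ne x}c_\Lambda(u)<\infty .$$ For $f\in C(E)$ let $\Delta_f(x)=\sup\{|f(\eta)-f(\zeta)| : \eta_y=\zeta_y \text{ for all } y\ne x\}$ and $|||f|||=\sum_{x\in S}\Delta_f(x)$; let $D=\{f\in C(E): |||f|||<\infty\}$ with the norm $\|f\|_D=|||f|||+\|f\|$, where $\|\cdot\|$ is the sup norm, and let $\tau_D$ be the norm topology. For $f\in D$ let $$Af(\eta)=\sum_\Lambda\int c_\Lambda(\eta,d\zeta)\,[f(\eta^\zeta)-f(\eta)],$$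 where $\eta^\zeta$ equals $\zeta$ on $\Lambda$ and $\eta$ off $\Lambda$. Then $(D,\|\cdot\|_D)$ is a separable Banach space. The series defining $Af$ converges to a continuous function for every $f\in D$, the operator $(A,D)$ in $C(E)$ is closable, and its closure (again denoted by $A$, with domain $\mathcal D(A)$) is the generator of a strongly continuous positive semigroup $S(t)$ on $C(E)$ with $S(t)1=1$. For this semigroup put $V(t)f=\log S(t)e^f$ and $Hf=e^{-f}Ae^f$. The following two sets of conditions hold. Condition 1. $D$ is dense in $C(E)$ and is a core for $A$: $D\subseteq\mathcal D(A)$, and for every $f\in\mathcal D(A)$ there are $f_n\in D$ with $f_n\to f$ and $Af_n\to Af$ in sup norm. If $f,g\in D$ then $fg\in D$. If $f\in D$ and $\phi$ is a real function that is smooth on an open neighbourhood of the range of $f$, then $\phi\circ f\in D$. Condition 2. (a) $(D,\tau_D)$ is a separable barrelled locally convex Hausdorff space. (b) $\tau_D$ is finer than the sup norm topology on $D$. (c) The maps $f\mapsto e^f-1$, $D\to D$, and $(f,g)\mapsto fg$, $D\times D\to D$, are well defined and $\tau_D$-continuous. (d) $S(t)D\subseteq D$ and $V(t)D\subseteq D$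 for all $t\ge0$; the maps $S(t),V(t):D\to D$ are $\tau_D$-continuous for every $t$, and $t\mapsto S(t)f$ and $t\mapsto V(t)f$ are $\tau_D$-continuous on $[0,\infty)$ for every $f\in D$. (e) $A:(D,\tau_D)\to(C(E),\|\cdot\|)$ is continuous. (f) $e^f\in\mathcal D(A)$ for every $f\in D$, and there is a barrel (a convex, balanced, absorbing and closed set) $\mathcal N\subseteq D$ with $\sup_{f\in\mathcal N}\|Hf\|\le1$ and $\sup_{f\in c\mathcal N}\|Hf\|<\infty$ for every $c>0$. -/

import Mathlib

open Filter Topology MeasureTheory Set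
open scoped NNReal ENNReal ContDiff Pointwise

noncomputable section

/-! ### Markov semigroups on `C(E)`, their generators and the conditions on a core -/

/-- A strongly continuous positive conservative (hence contractive) semigroup on `C(E)`,
where `E` is compact. -/
structure MarkovSemigroup (E : Type*) [TopologicalSpace E] [CompactSpace E] where
  op : ℝ≥0 → C(E, ℝ) →L[ℝ] C(E, ℝ)
  op_zero : op 0 = ContinuousLinearMap.id ℝ C(E, ℝ)
  op_add : ∀ s t, op (s + t) = (op s).comp (op t)
  op_nonneg : ∀ t f, 0 ≤ f → 0 ≤ op t f
  op_one : ∀ t, op t 1 = 1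
  continuous_op : ∀ f, Continuous fun t => op t f

namespace MarkovSemigroup

variable {E : Type*} [TopologicalSpace E] [CompactSpace E]

/-- `g` is the derivative at time `0` (from the right, in sup norm) of `t ↦ T(t) f`. -/
def HasGenerator (T : MarkovSemigroup E) (f g : C(E, ℝ)) : Prop :=
  Tendsto (fun t : ℝ≥0 => (t : ℝ)⁻¹ • (T.op t f - f)) (𝓝[>] 0) (𝓝 g)

theorem HasGenerator.add {T : MarkovSemigroup E} {f g f' g' : C(E, ℝ)}
    (h : T.HasGenerator f g) (h' : T.HasGenerator f' g') : T.HasGenerator (f + f') (g + g') := by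
  refine (Tendsto.add h h').congr fun t => ?_
  rw [map_add, ← smul_add]
  congr 1
  abel

theorem HasGenerator.smul {T : MarkovSemigroup E} {f g : C(E, ℝ)} (a : ℝ)
    (h : T.HasGenerator f g) : T.HasGenerator (a • f) (a • g) := by
  refine (Tendsto.const_smul h a).congr fun t => ?_
  rw [map_smul, ← smul_sub, smul_comm]

theorem HasGenerator.unique {T : MarkovSemigroup E} {f g g' : C(E, ℝ)}
    (h : T.HasGenerator f g) (h' : T.HasGenerator f g') : g = g' :=
  tendsto_nhds_unique h h'

/-- The infinitesimal generator, with its maximal domain. -/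
def generator (T : MarkovSemigroup E) : C(E, ℝ) →ₗ.[ℝ] C(E, ℝ) where
  domain :=
    { carrier := {f | ∃ g, T.HasGenerator f g}
      zero_mem' := ⟨0, by simp [HasGenerator]⟩
      add_mem' := fun ⟨g, hg⟩ ⟨g', hg'⟩ => ⟨g + g', hg.add hg'⟩
      smul_mem' := fun a _ ⟨g, hg⟩ => ⟨a • g, hg.smul a⟩ }
  toFun :=
    { toFun := fun f => Classical.choose f.2
      map_add' := fun f f' =>
        (Classical.choose_spec (f + f').2).unique
          ((Classical.choose_spec f.2).add (Classical.choose_spec f'.2))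
      map_smul' := fun a f =>
        (Classical.choose_spec (a • f).2).unique ((Classical.choose_spec f.2).smul a) }

end MarkovSemigroup

/-- The continuous function `e^f`. -/
def expFun {E : Type*} [TopologicalSpace E] (f : C(E, ℝ)) : C(E, ℝ) :=
  ⟨fun x => Real.exp (f x), Real.continuous_exp.comp f.continuous⟩

/-- `H f = e^{-f} A e^f`, for `f` such that `e^f` is in the domain of `A`. -/
def hamiltonian {E : Type*} [TopologicalSpace E] [CompactSpace E]
    (A : C(E, ℝ) →ₗ.[ℝ] C(E, ℝ)) (f : C(E, ℝ)) (hf : expFun f ∈ A.domain) : C(E, ℝ) :=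
  expFun (-f) * A ⟨expFun f, hf⟩

/-- A barrel: a convex, balanced, absorbing and closed set. -/
structure IsBarrel {X : Type*} [AddCommGroup X] [Module ℝ X] [TopologicalSpace X]
    (B : Set X) : Prop where
  convex : Convex ℝ B
  balanced : Balanced ℝ B
  absorbent : Absorbent ℝ B
  isClosed : IsClosed B

/-- The first set of conditions, for compact `E`. The core `D` is the range of the injective
linear map `ι : X → C(E)`: a dense subalgebra of `C(E)`, a core for the generator, stable under
composition with functions that are smooth (on a neighbourhood of the range). -/
structure AlgebraCoreCondition {E X : Type*} [TopologicalSpace E] [CompactSpace E]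
    [AddCommGroup X] [Module ℝ X] (T : MarkovSemigroup E) (ι : X →ₗ[ℝ] C(E, ℝ)) : Prop where
  injective : Function.Injective ι
  le_domain : ∀ f : X, ι f ∈ T.generator.domain
  core : ∀ f : T.generator.domain, ∃ u : ℕ → X,
    Tendsto (fun n => ι (u n)) atTop (𝓝 (f : C(E, ℝ))) ∧
    Tendsto (fun n => T.generator ⟨ι (u n), le_domain (u n)⟩) atTop (𝓝 (T.generator f))
  dense : DenseRange ι
  mul_mem : ∀ f g : X, ∃ h : X, ι h = ι f * ι g
  smooth_comp_mem : ∀ (f : X) (φ : ℝ → ℝ) (U : Set ℝ), IsOpen U → range (ι f) ⊆ U →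
    ContDiffOn ℝ ∞ φ U → ∃ g : X, ∀ x, ι g x = φ (ι f x)

/-- The second set of conditions, for the topology of `X` carried over to the core
`D = range ι`. Here `V(t) f = log T(t) e^f` and `H f = e^{-f} A e^f`. -/
structure TopologicalCoreCondition {E X : Type*} [TopologicalSpace E] [CompactSpace E]
    [AddCommGroup X] [Module ℝ X] [TopologicalSpace X]
    (T : MarkovSemigroup E) (ι : X →ₗ[ℝ] C(E, ℝ)) : Prop
    extends AlgebraCoreCondition T ι where
  isTopologicalAddGroup : IsTopologicalAddGroup X
  continuousSMul : ContinuousSMul ℝ X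
  locallyConvex : LocallyConvexSpace ℝ X
  hausdorff : T2Space X
  separable : TopologicalSpace.SeparableSpace X
  barrelled : ∀ B : Set X, IsBarrel B → B ∈ 𝓝 (0 : X)
  finer : Continuous ι
  exp_sub_one : ∃ F : X → X, (∀ f, ι (F f) = expFun (ι f) - 1) ∧ Continuous F
  mul : ∃ F : X × X → X, (∀ p, ι (F p) = ι p.1 * ι p.2) ∧ Continuous F
  semigroup : ∃ F : ℝ≥0 → X → X, (∀ t f, ι (F t f) = T.op t (ι f)) ∧
    (∀ t, Continuous (F t)) ∧ ∀ f, Continuous fun t => F t f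
  log_semigroup : ∃ F : ℝ≥0 → X → X,
    (∀ t f x, ι (F t f) x = Real.log (T.op t (expFun (ι f)) x)) ∧
    (∀ t, Continuous (F t)) ∧ ∀ f, Continuous fun t => F t f
  continuous_generator : Continuous fun f : X => T.generator ⟨ι f, le_domain f⟩
  exp_mem_domain : ∀ f : X, expFun (ι f) ∈ T.generator.domain
  hamiltonian_bound : ∃ N : Set X, IsBarrel N ∧
    (∀ f ∈ N, ‖hamiltonian T.generator (ι f) (exp_mem_domain f)‖ ≤ 1) ∧
    ∀ c : ℝ, 0 < c → ∃ M : ℝ, ∀ f ∈ c • N,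
      ‖hamiltonian T.generator (ι f) (exp_mem_domain f)‖ ≤ M

/-! ### Interacting particle systems -/

namespace IPS

section TestFunctions

variable {W S : Type*} [TopologicalSpace W] [CompactSpace W]

/-- `Δ_f(x)`, the variation of `f` at the site `x`. -/
def variation (f : C(S → W, ℝ)) (x : S) : ℝ≥0∞ :=
  ⨆ (η : S → W) (ζ : S → W) (_ : ∀ y, y ≠ x → η y = ζ y), ENNReal.ofReal |f η - f ζ|

/-- `|||f||| = ∑ₓ Δ_f(x)`. -/
def tripleNorm (f : C(S → W, ℝ)) : ℝ≥0∞ := ∑' x, variation f x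

theorem variation_zero (x : S) : variation (0 : C(S → W, ℝ)) x = 0 := by
  simp [variation]

theorem variation_add_le (f g : C(S → W, ℝ)) (x : S) :
    variation (f + g) x ≤ variation f x + variation g x := by
  refine iSup_le fun η => iSup_le fun ζ => iSup_le fun h => ?_
  calc ENNReal.ofReal |(f + g) η - (f + g) ζ|
      ≤ ENNReal.ofReal (|f η - f ζ| + |g η - g ζ|) := by
        refine ENNReal.ofReal_le_ofReal ?_
        have : (f + g) η - (f + g) ζ = (f η - f ζ) + (g η - g ζ) := by
          simp only [ContinuousMap.add_apply]; ring
        rw [this]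
        exact abs_add_le _ _
    _ = ENNReal.ofReal |f η - f ζ| + ENNReal.ofReal |g η - g ζ| :=
        ENNReal.ofReal_add (abs_nonneg _) (abs_nonneg _)
    _ ≤ variation f x + variation g x :=
        add_le_add
          (le_iSup_of_le η (le_iSup_of_le ζ
            (le_iSup (fun _ : ∀ y, y ≠ x → η y = ζ y => ENNReal.ofReal |f η - f ζ|) h)))
          (le_iSup_of_le η (le_iSup_of_le ζ
            (le_iSup (fun _ : ∀ y, y ≠ x → η y = ζ y => ENNReal.ofReal |g η - g ζ|) h)))

theorem variation_smul (a : ℝ) (f : C(S → W, ℝ)) (x : S) :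
    variation (a • f) x = ENNReal.ofReal |a| * variation f x := by
  simp only [variation, ENNReal.mul_iSup]
  refine iSup_congr fun η => iSup_congr fun ζ => iSup_congr fun _ => ?_
  rw [← ENNReal.ofReal_mul (abs_nonneg a), ← abs_mul]
  simp [mul_sub]

theorem tripleNorm_zero : tripleNorm (0 : C(S → W, ℝ)) = 0 := by
  simp [tripleNorm, variation_zero]

theorem tripleNorm_add_le (f g : C(S → W, ℝ)) :
    tripleNorm (f + g) ≤ tripleNorm f + tripleNorm g := by
  rw [tripleNorm, tripleNorm, tripleNorm, ← ENNReal.tsum_add]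
  exact ENNReal.tsum_le_tsum fun x => variation_add_le f g x

theorem tripleNorm_smul (a : ℝ) (f : C(S → W, ℝ)) :
    tripleNorm (a • f) = ENNReal.ofReal |a| * tripleNorm f := by
  simp only [tripleNorm, variation_smul, ENNReal.tsum_mul_left]

variable (W S) in
/-- The space of test functions `D = {f ∈ C(E) : |||f||| < ∞}`, where `E = W^S`. -/
def testFunctions : Submodule ℝ C(S → W, ℝ) where
  carrier := {f | tripleNorm f < ⊤}
  zero_mem' := by simp [tripleNorm_zero]
  add_mem' := fun hf hg =>
    (tripleNorm_add_le _ _).trans_lt (ENNReal.add_lt_top.2 ⟨hf, hg⟩)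
  smul_mem' := fun a f hf => by
    change tripleNorm (a • f) < ⊤
    rw [tripleNorm_smul]
    exact ENNReal.mul_lt_top ENNReal.ofReal_lt_top hf

variable (W S) in
/-- The space `D` again, as a type that will carry the norm `|||·||| + ‖·‖` (and not the sup
norm inherited from `C(E)`). -/
def TestSpace : Type _ := testFunctions W S

instance : AddCommGroup (TestSpace W S) := inferInstanceAs (AddCommGroup (testFunctions W S))

instance : Module ℝ (TestSpace W S) := inferInstanceAs (Module ℝ (testFunctions W S))

variable (W S) in
/-- The inclusion of `D` in `C(E)`. -/
def TestSpace.incl : TestSpace W S →ₗ[ℝ] C(S → W, ℝ) := (testFunctions W S).subtype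

instance : Norm (TestSpace W S) :=
  ⟨fun f => (tripleNorm (TestSpace.incl W S f)).toReal + ‖TestSpace.incl W S f‖⟩

theorem TestSpace.normedSpaceCore : NormedSpace.Core ℝ (TestSpace W S) where
  norm_nonneg f := add_nonneg ENNReal.toReal_nonneg (norm_nonneg _)
  norm_smul a f := by
    change (tripleNorm (TestSpace.incl W S (a • f))).toReal + ‖TestSpace.incl W S (a • f)‖ =
      ‖a‖ * ((tripleNorm (TestSpace.incl W S f)).toReal + ‖TestSpace.incl W S f‖)
    rw [map_smul, tripleNorm_smul, norm_smul, ENNReal.toReal_mul,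
      ENNReal.toReal_ofReal (abs_nonneg a), Real.norm_eq_abs, mul_add]
  norm_triangle f g := by
    change (tripleNorm (TestSpace.incl W S (f + g))).toReal + ‖TestSpace.incl W S (f + g)‖ ≤
      ((tripleNorm (TestSpace.incl W S f)).toReal + ‖TestSpace.incl W S f‖) +
      ((tripleNorm (TestSpace.incl W S g)).toReal + ‖TestSpace.incl W S g‖)
    have hf : tripleNorm (TestSpace.incl W S f) ≠ ⊤ := f.2.ne
    have hg : tripleNorm (TestSpace.incl W S g) ≠ ⊤ := g.2.ne
    have h1 := ENNReal.toReal_mono (ENNReal.add_ne_top.2 ⟨hf, hg⟩)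
      (tripleNorm_add_le (TestSpace.incl W S f) (TestSpace.incl W S g))
    rw [ENNReal.toReal_add hf hg] at h1
    have h2 := norm_add_le (TestSpace.incl W S f) (TestSpace.incl W S g)
    rw [map_add]
    linarith
  norm_eq_zero_iff f := by
    change (tripleNorm (TestSpace.incl W S f)).toReal + ‖TestSpace.incl W S f‖ = 0 ↔ f = 0
    constructor
    · intro h
      have h1 : 0 ≤ (tripleNorm (TestSpace.incl W S f)).toReal := ENNReal.toReal_nonneg
      have h2 : ‖TestSpace.incl W S f‖ = 0 := by
        linarith [norm_nonneg (TestSpace.incl W S f)]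
      exact Subtype.ext (norm_eq_zero.1 h2)
    · rintro rfl
      simp [tripleNorm_zero]

/-- `‖f‖_D = |||f||| + ‖f‖`. -/
instance : NormedAddCommGroup (TestSpace W S) :=
  NormedAddCommGroup.ofCore TestSpace.normedSpaceCore

instance : NormedSpace ℝ (TestSpace W S) := NormedSpace.ofCore TestSpace.normedSpaceCore

end TestFunctions

section Rates

variable {W S : Type*} [MetricSpace W] [CompactSpace W] [MeasurableSpace W] [BorelSpace W]

variable (W S) in
/-- The transition rates `c_Λ(η, dζ)`: for every finite set of sites `Λ` and every configuration
`η` a finite measure on `W^Λ`, depending on `η` in a weakly continuous way. -/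
abbrev Rates : Type _ := (Λ : Finset S) → C(S → W, FiniteMeasure (Λ → W))

/-- `c_Λ`, the maximal total mass of `c_Λ(η, ·)`. -/
def maxRate (c : Rates W S) (Λ : Finset S) : ℝ≥0∞ :=
  ⨆ η : S → W, (c Λ η : Measure (Λ → W)) univ

/-- `c_Λ(u)`, the dependence in total variation of `c_Λ(η, ·)` on the coordinate `η_u`. -/
def rateDependence (c : Rates W S) (Λ : Finset S) (u : S) : ℝ≥0∞ :=
  ⨆ (η : S → W) (η' : S → W) (_ : ∀ y, y ≠ u → η y = η' y),
    ((c Λ η : Measure (Λ → W)).toSignedMeasure -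
      (c Λ η' : Measure (Λ → W)).toSignedMeasure).totalVariation univ

open Classical in
/-- The configuration `η^ζ`, equal to `ζ` on `Λ` and to `η` off `Λ`. -/
def modify {Λ : Finset S} (η : S → W) (ζ : Λ → W) : S → W :=
  fun x => if h : x ∈ Λ then ζ ⟨x, h⟩ else η x

/-- `∫ c_Λ(η, dζ) [f(η^ζ) - f(η)]`. -/
def jumpTerm (c : Rates W S) (f : C(S → W, ℝ)) (η : S → W) (Λ : Finset S) : ℝ :=
  ∫ ζ : Λ → W, (f (modify η ζ) - f η) ∂(c Λ η : Measure (Λ → W))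

/-- `g(η) = ∑_Λ ∫ c_Λ(η, dζ) [f(η^ζ) - f(η)]` for all `η`. -/
def HasFormalGenerator (c : Rates W S) (f g : C(S → W, ℝ)) : Prop :=
  ∀ η, HasSum (jumpTerm c f η) (g η)

theorem continuous_modify {Λ : Finset S} (η : S → W) :
    Continuous fun ζ : Λ → W => modify η ζ := by
  refine continuous_pi fun x => ?_
  by_cases h : x ∈ Λ
  · simpa [modify, h] using continuous_apply (⟨x, h⟩ : Λ)
  · simpa [modify, h] using continuous_const

theorem integrable_jump (c : Rates W S) (f : C(S → W, ℝ)) (η : S → W) (Λ : Finset S) :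
    Integrable (fun ζ : Λ → W => f (modify η ζ) - f η) (c Λ η : Measure (Λ → W)) :=
  ((f.continuous.comp (continuous_modify η)).sub continuous_const).integrable_of_hasCompactSupport
    (HasCompactSupport.of_compactSpace _)

theorem HasFormalGenerator.add {c : Rates W S} {f g f' g' : C(S → W, ℝ)}
    (h : HasFormalGenerator c f g) (h' : HasFormalGenerator c f' g') :
    HasFormalGenerator c (f + f') (g + g') := by
  intro η
  refine ((h η).add (h' η)).congr_fun fun Λ => ?_
  rw [jumpTerm, jumpTerm, jumpTerm,
    ← integral_add (integrable_jump c f η Λ) (integrable_jump c f' η Λ)]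
  congr 1
  funext ζ
  simp only [ContinuousMap.add_apply]
  ring

theorem HasFormalGenerator.smul {c : Rates W S} {f g : C(S → W, ℝ)} (a : ℝ)
    (h : HasFormalGenerator c f g) : HasFormalGenerator c (a • f) (a • g) := by
  intro η
  refine ((h η).mul_left a).congr_fun fun Λ => ?_
  rw [jumpTerm, jumpTerm, ← integral_const_mul]
  congr 1
  funext ζ
  simp [mul_sub]

theorem HasFormalGenerator.unique {c : Rates W S} {f g g' : C(S → W, ℝ)}
    (h : HasFormalGenerator c f g) (h' : HasFormalGenerator c f g') : g = g' :=
  ContinuousMap.ext fun η => (h η).unique (h' η)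

/-- The formal generator `A f(η) = ∑_Λ ∫ c_Λ(η, dζ) [f(η^ζ) - f(η)]`, on all those `f ∈ D` for
which the series converges to a continuous function of `η`. -/
def formalGenerator (c : Rates W S) : C(S → W, ℝ) →ₗ.[ℝ] C(S → W, ℝ) where
  domain :=
    { carrier := {f | f ∈ testFunctions W S ∧ ∃ g, HasFormalGenerator c f g}
      zero_mem' := ⟨zero_mem _, 0, fun η => by
        have : jumpTerm c 0 η = fun _ => 0 := by funext Λ; simp [jumpTerm]
        rw [this]
        exact hasSum_zero⟩
      add_mem' := fun ⟨hf, g, hg⟩ ⟨hf', g', hg'⟩ => ⟨add_mem hf hf', g + g', hg.add hg'⟩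
      smul_mem' := fun a _ ⟨hf, g, hg⟩ => ⟨Submodule.smul_mem _ a hf, a • g, hg.smul a⟩ }
  toFun :=
    { toFun := fun f => Classical.choose f.2.2
      map_add' := fun f f' =>
        (Classical.choose_spec (f + f').2.2).unique
          ((Classical.choose_spec f.2.2).add (Classical.choose_spec f'.2.2))
      map_smul' := fun a f =>
        (Classical.choose_spec (a • f).2.2).unique ((Classical.choose_spec f.2.2).smul a) }

end Rates

end IPS

end

open Filter Topology MeasureTheory Set
open scoped NNReal ENNReal ContDiff Pointwise

/-! The dynamics is the limit of dynamics in which only a finite collection `F` of sets `Λ` is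
active. Then the generator is bounded and equals `m (P - 1)` with `P` positive and `P 1 = 1`, so
`exp (t m (P - 1))` is a Markov semigroup (`finiteSemigroup`).

The limit exists because variations are controlled uniformly in `F`. Suppose `b` bounds the
variations of `f` site by site and is superharmonic: `∑_Λ c_Λ(x) ∑_{y ∈ Λ} b(y) ≤ κ b(x)`. Then a
step of `P` multiplies the bound by at most `1 + κ/m`, and exponentiation gives the bound `e^{κt} b`
at time `t`, free of `m` and `F` (`varBound_finiteSemigroup`). The two hypotheses on the rates say
that the kernel acts boundedly on `ℓ¹(S)`, so a resolvent series provides every `f ∈ D` with such a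
majorant, of sum at most `2 |||f|||` (`exists_superharmonic`). Duhamel's formula
(`norm_op_sub_op_le`) makes the finite semigroups Cauchy on the dense set `D`; the limit inherits
the bound, and its generator extends the formal one.

The rest follows from this bound. `D` is invariant, hence a core (`HasGenerator.mem_of_core`), so
the generator is the closure of the formal one. Since a generator with dense domain determines its
semigroup, one semigroup has to be checked. In `D`, sup norm convergence with summably dominated
variations implies convergence (`tendsto_of_dominated`); this gives continuity in time and of
composition with Lipschitz functions, hence of `exp`, `log` and `V(t)`. `D` is complete, so
barrelled by Baire, and cylinder functions make it separable. Finally `‖A f‖ ≤ K |||f|||` gives `‖H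
f‖ ≤ K R e^{2R}` on the ball of radius `R`, and a small ball is the required barrel. -/

theorem tendsto_sub_nhdsGT (s : ℝ) : Tendsto (fun r : ℝ => r - s) (𝓝[>] s) (𝓝[>] 0) := by
  refine tendsto_nhdsWithin_iff.2 ⟨?_, ?_⟩
  · have : Tendsto (fun r : ℝ => r - s) (𝓝 s) (𝓝 (s - s)) :=
      (continuous_id.sub continuous_const).tendsto s
    rw [sub_self] at this
    exact this.mono_left nhdsWithin_le_nhds
  · filter_upwards [self_mem_nhdsWithin] with r hr
    simpa using hr

/-! ### Calculus of Markov semigroups and their generators. -/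

namespace MarkovSemigroup

variable {E : Type*} [TopologicalSpace E] [CompactSpace E]

theorem op_mono (T : MarkovSemigroup E) (t : ℝ≥0) {f g : C(E, ℝ)} (h : f ≤ g) :
    T.op t f ≤ T.op t g := by
  have := T.op_nonneg t (g - f) (sub_nonneg.2 h)
  rwa [map_sub, sub_nonneg] at this

/-- Positivity and conservation of `1`, applied to `± f ≤ ‖f‖ • 1`. -/
theorem norm_op_le (T : MarkovSemigroup E) (t : ℝ≥0) (f : C(E, ℝ)) : ‖T.op t f‖ ≤ ‖f‖ := by
  have h1 : f ≤ ‖f‖ • (1 : C(E, ℝ)) := fun x => by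
    simpa using (le_abs_self _).trans (f.norm_coe_le_norm x)
  have h2 : -f ≤ ‖f‖ • (1 : C(E, ℝ)) := fun x => by
    simpa using (neg_le_abs _).trans (f.norm_coe_le_norm x)
  have h1' := T.op_mono t h1
  have h2' := T.op_mono t h2
  rw [map_smul, T.op_one] at h1' h2'
  rw [map_neg] at h2'
  refine (ContinuousMap.norm_le _ (norm_nonneg _)).2 fun x => abs_le.2 ⟨?_, ?_⟩
  · have := h2' x
    simp at this
    linarith
  · simpa using h1' x

theorem norm_op_sub_le (T : MarkovSemigroup E) (t : ℝ≥0) (f g : C(E, ℝ)) :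
    ‖T.op t f - T.op t g‖ ≤ ‖f - g‖ := by
  rw [← map_sub]; exact T.norm_op_le t _

theorem op_add_apply (T : MarkovSemigroup E) (s t : ℝ≥0) (f : C(E, ℝ)) :
    T.op (s + t) f = T.op s (T.op t f) := by
  rw [T.op_add]; rfl

theorem op_zero_apply (T : MarkovSemigroup E) (f : C(E, ℝ)) : T.op 0 f = f := by
  rw [T.op_zero]; rfl

theorem continuous_op_toNNReal (T : MarkovSemigroup E) (f : C(E, ℝ)) :
    Continuous fun s : ℝ => T.op s.toNNReal f :=
  (T.continuous_op f).comp continuous_real_toNNReal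

/-- The joint continuity of `(t, f) ↦ T(t) f`. -/
theorem tendsto_op (T : MarkovSemigroup E) {ι : Type*} {l : Filter ι} {t : ι → ℝ≥0} {t₀ : ℝ≥0}
    {f : ι → C(E, ℝ)} {f₀ : C(E, ℝ)} (ht : Tendsto t l (𝓝 t₀)) (hf : Tendsto f l (𝓝 f₀)) :
    Tendsto (fun i => T.op (t i) (f i)) l (𝓝 (T.op t₀ f₀)) := by
  have h1 : Tendsto (fun i => T.op (t i) f₀) l (𝓝 (T.op t₀ f₀)) :=
    ((T.continuous_op f₀).tendsto t₀).comp ht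
  have h2 : Tendsto (fun i => T.op (t i) (f i) - T.op (t i) f₀) l (𝓝 0) :=
    squeeze_zero_norm (fun i => T.norm_op_sub_le _ _ _)
      (by simpa using (tendsto_iff_norm_sub_tendsto_zero.1 hf))
  simpa using h2.add h1

/-- Generators are defined with time in `ℝ≥0`, whereas derivatives and integrals need real time;
this identity of filters carries limits from one to the other. -/
theorem map_toNNReal_nhdsGT_zero : map Real.toNNReal (𝓝[>] (0 : ℝ)) = 𝓝[>] (0 : ℝ≥0) := by
  refine le_antisymm ?_ ?_
  · refine tendsto_nhdsWithin_iff.2 ⟨?_, ?_⟩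
    · have := (continuous_real_toNNReal.tendsto 0).mono_left
        (nhdsWithin_le_nhds (s := Ioi (0 : ℝ)))
      simpa using this
    · filter_upwards [self_mem_nhdsWithin] with h hh
      simpa using hh
  · have h1 : Tendsto (fun t : ℝ≥0 => (t : ℝ)) (𝓝[>] 0) (𝓝[>] 0) := by
      refine tendsto_nhdsWithin_iff.2 ⟨?_, ?_⟩
      · simpa using (NNReal.continuous_coe.tendsto 0).mono_left
          (nhdsWithin_le_nhds (s := Ioi (0 : ℝ≥0)))
      · filter_upwards [self_mem_nhdsWithin] with h hh
        simpa using hh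
    have h2 := (tendsto_map (f := Real.toNNReal)).comp h1
    have h3 : (Real.toNNReal ∘ fun t : ℝ≥0 => (t : ℝ)) = id := by funext t; simp
    rw [h3] at h2
    exact h2

theorem hasGenerator_iff_real {T : MarkovSemigroup E} {f g : C(E, ℝ)} :
    T.HasGenerator f g ↔
      Tendsto (fun h : ℝ => h⁻¹ • (T.op h.toNNReal f - f)) (𝓝[>] 0) (𝓝 g) := by
  rw [HasGenerator, ← map_toNNReal_nhdsGT_zero, tendsto_map'_iff]
  refine tendsto_congr' ?_
  filter_upwards [self_mem_nhdsWithin] with h hh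
  simp [Real.coe_toNNReal h (le_of_lt hh)]

theorem HasGenerator.op {T : MarkovSemigroup E} {f g : C(E, ℝ)} (h : T.HasGenerator f g)
    (s : ℝ≥0) : T.HasGenerator (T.op s f) (T.op s g) := by
  refine (((T.op s).continuous.tendsto g).comp h).congr fun t => ?_
  simp only [Function.comp, map_smul, map_sub]
  rw [← T.op_add_apply, ← T.op_add_apply, add_comm]

/-- The semigroup property moves the difference quotient at `s` back to time `0`. Right derivatives
suffice for the fundamental theorem of calculus and the mean value inequality used below. -/
theorem HasGenerator.hasDerivWithinAt {T : MarkovSemigroup E} {f g : C(E, ℝ)}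
    (h : T.HasGenerator f g) {s : ℝ} (hs : 0 ≤ s) :
    HasDerivWithinAt (fun s : ℝ => T.op s.toNNReal f) (T.op s.toNNReal g) (Ici s) s := by
  rw [← hasDerivWithinAt_Ioi_iff_Ici, hasDerivWithinAt_iff_tendsto_slope' (by simp)]
  have h1 := hasGenerator_iff_real.1 (h.op s.toNNReal)
  have h2 := tendsto_sub_nhdsGT s
  refine (h1.comp h2).congr' ?_
  filter_upwards [self_mem_nhdsWithin] with r hr
  have hr' : (0 : ℝ) ≤ r - s := (sub_pos.2 hr).le
  simp only [Function.comp, slope, vsub_eq_sub]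
  rw [← T.op_add_apply, ← Real.toNNReal_add hr' hs, sub_add_cancel]

/-- `T(t) f - f = ∫₀ᵗ T(s) g ds` if `g` is the image of `f` under the generator. -/
theorem HasGenerator.integral_eq {T : MarkovSemigroup E} {f g : C(E, ℝ)}
    (h : T.HasGenerator f g) {t : ℝ} (ht : 0 ≤ t) :
    ∫ s in (0 : ℝ)..t, T.op s.toNNReal g = T.op t.toNNReal f - f := by
  rw [intervalIntegral.integral_eq_sub_of_hasDeriv_right_of_le ht
    (T.continuous_op_toNNReal f).continuousOn (f' := fun s => T.op s.toNNReal g)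
    (fun s hs => (h.hasDerivWithinAt hs.1.le).mono Ioi_subset_Ici_self)
    ((T.continuous_op_toNNReal g).intervalIntegrable _ _)]
  simp [T.op_zero_apply]

theorem tendsto_average (T : MarkovSemigroup E) (g : C(E, ℝ)) :
    Tendsto (fun h : ℝ => h⁻¹ • ∫ s in (0 : ℝ)..h, T.op s.toNNReal g) (𝓝[>] 0) (𝓝 g) := by
  have h1 : HasDerivAt (fun h : ℝ => ∫ s in (0 : ℝ)..h, T.op s.toNNReal g) g 0 := by
    have := (T.continuous_op_toNNReal g).integral_hasStrictDerivAt 0 0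
    simpa [T.op_zero_apply] using this.hasDerivAt
  have h2 := (hasDerivAt_iff_tendsto_slope_zero.1 h1).mono_left
    (nhdsWithin_mono 0 (fun x (hx : x ∈ Ioi (0 : ℝ)) => ne_of_gt hx))
  simpa using h2

/-- Converse of `HasGenerator.integral_eq`: the generator is characterised by an integral equation,
which passes to limits more easily than a derivative. -/
theorem hasGenerator_of_integral_eq {T : MarkovSemigroup E} {f g : C(E, ℝ)}
    (h : ∀ t : ℝ, 0 ≤ t → ∫ s in (0 : ℝ)..t, T.op s.toNNReal g = T.op t.toNNReal f - f) :
    T.HasGenerator f g := by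
  refine hasGenerator_iff_real.2 ((T.tendsto_average g).congr' ?_)
  filter_upwards [self_mem_nhdsWithin] with t ht
  rw [h t (le_of_lt ht)]

/-- Limits of semigroups and of their generators. -/
theorem HasGenerator.of_tendsto {ι : Type*} {l : Filter ι} [l.NeBot] {U : ι → MarkovSemigroup E}
    {T : MarkovSemigroup E} {u v : ι → C(E, ℝ)} {f g : C(E, ℝ)}
    (hU : ∀ i, (U i).HasGenerator (u i) (v i))
    (hf : Tendsto u l (𝓝 f)) (hg : Tendsto v l (𝓝 g))
    (hUf : ∀ t, Tendsto (fun i => (U i).op t f) l (𝓝 (T.op t f)))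
    (hUg : ∀ t₀ : ℝ≥0, TendstoUniformlyOn (fun i t => (U i).op t g) (fun t => T.op t g) l
      (Iic t₀)) :
    T.HasGenerator f g := by
  refine hasGenerator_of_integral_eq fun t ht => ?_
  have h1 : Tendsto (fun i => (U i).op t.toNNReal (u i) - u i) l (𝓝 (T.op t.toNNReal f - f)) := by
    refine Tendsto.sub ?_ hf
    have h2 : Tendsto (fun i => (U i).op t.toNNReal (u i) - (U i).op t.toNNReal f) l (𝓝 0) :=
      squeeze_zero_norm (fun i => (U i).norm_op_sub_le _ _ _)
        (by simpa using (tendsto_iff_norm_sub_tendsto_zero.1 hf))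
    simpa using h2.add (hUf t.toNNReal)
  refine tendsto_nhds_unique ?_ h1
  simp_rw [← fun i => (hU i).integral_eq ht]
  rw [tendsto_iff_norm_sub_tendsto_zero, Metric.tendsto_nhds]
  intro ε hε
  obtain ⟨δ, hδ, hδε⟩ : ∃ δ > 0, δ * t < ε / 2 + ε / 4 := by
    refine ⟨ε / 2 / (t + 1), by positivity, ?_⟩
    rw [div_mul_eq_mul_div, div_lt_iff₀ (by positivity)]
    nlinarith
  filter_upwards [Metric.tendstoUniformlyOn_iff.1 (hUg t.toNNReal) (δ / 2) (by positivity),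
    (tendsto_iff_norm_sub_tendsto_zero.1 hg).eventually (gt_mem_nhds (half_pos hδ))] with i hi hi'
  rw [← intervalIntegral.integral_sub (((U i).continuous_op_toNNReal _).intervalIntegrable _ _)
    ((T.continuous_op_toNNReal _).intervalIntegrable _ _)]
  -- Half of `δ` pays for `v i → g`, through contractivity, and half for the convergence of the
  -- semigroups at `g`.
  have h3 : ∀ s ∈ Set.uIoc 0 t, ‖(U i).op s.toNNReal (v i) - T.op s.toNNReal g‖ ≤ δ := by
    intro s hs
    rw [uIoc_of_le ht] at hs
    have h4 := hi s.toNNReal (Real.toNNReal_le_toNNReal hs.2)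
    rw [dist_comm, dist_eq_norm] at h4
    calc ‖(U i).op s.toNNReal (v i) - T.op s.toNNReal g‖
        ≤ ‖(U i).op s.toNNReal (v i) - (U i).op s.toNNReal g‖ +
          ‖(U i).op s.toNNReal g - T.op s.toNNReal g‖ := norm_sub_le_norm_sub_add_norm_sub _ _ _
      _ ≤ δ / 2 + δ / 2 := add_le_add (((U i).norm_op_sub_le _ _ _).trans hi'.le) h4.le
      _ = δ := by ring
  have h5 := intervalIntegral.norm_integral_le_of_norm_le_const h3
  rw [sub_zero, abs_of_nonneg ht] at h5
  simp only [dist_zero_right, norm_norm]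
  linarith

/-- The generator is closed. -/
theorem isClosed_hasGenerator (T : MarkovSemigroup E) :
    IsClosed {p : C(E, ℝ) × C(E, ℝ) | T.HasGenerator p.1 p.2} := by
  refine IsSeqClosed.isClosed fun u p hu hp => ?_
  refine HasGenerator.of_tendsto (l := atTop) (U := fun _ => T) (fun i => hu i)
    ((continuous_fst.tendsto p).comp hp) ((continuous_snd.tendsto p).comp hp)
    (fun t => tendsto_const_nhds) (fun t₀ => ?_)
  exact Metric.tendstoUniformlyOn_iff.2 fun ε hε => .of_forall fun i x _ => by simpa using hε

/-- Two semigroups are close to each other if their generators are. -/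
theorem norm_op_sub_op_le {T T' : MarkovSemigroup E} {f : C(E, ℝ)} {t : ℝ≥0} {ε : ℝ}
    (h : ∀ s ≤ t, ∃ g g', T.HasGenerator (T'.op s f) g ∧ T'.HasGenerator (T'.op s f) g' ∧
      ‖g' - g‖ ≤ ε) :
    ‖T'.op t f - T.op t f‖ ≤ ε * t := by
  choose! g g' hg hg' hε using h
  -- Duhamel interpolation from `T.op t f` at `0` to `T'.op t f` at `t`. Its right derivative is
  -- `T(t - s) (A' - A) T'(s) f`, of norm at most `ε` by contractivity.
  let u : ℝ → C(E, ℝ) := fun s => T.op (t - s.toNNReal) (T'.op s.toNNReal f)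
  have hu : Continuous u := by
    refine continuous_iff_continuousAt.2 fun s => T.tendsto_op ?_ ?_
    · exact (continuous_const.sub continuous_real_toNNReal).tendsto s
    · exact (T'.continuous_op_toNNReal f).tendsto s
  have h1 := norm_image_sub_le_of_norm_deriv_right_le_segment (f := u) (a := 0) (b := t) (C := ε)
    (f' := fun s => T.op (t - s.toNNReal) (g' s.toNNReal - g s.toNNReal)) hu.continuousOn
    (fun s hs => ?_) (fun s hs => ?_) t ⟨t.2, le_rfl⟩
  · simpa [u, T.op_zero_apply, T'.op_zero_apply] using h1
  · have hst : s.toNNReal ≤ t := by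
      rw [← Real.toNNReal_coe (r := t)]; exact Real.toNNReal_le_toNNReal hs.2.le
    rw [← hasDerivWithinAt_Ioi_iff_Ici, hasDerivWithinAt_iff_tendsto_slope' (by simp)]
    have h2 := tendsto_sub_nhdsGT s
    have h3 := ((hasGenerator_iff_real.1 (hg' _ hst)).sub
      (hasGenerator_iff_real.1 (hg _ hst))).comp h2
    have hsub : Continuous fun r : ℝ => t - r.toNNReal :=
      continuous_const.sub continuous_real_toNNReal
    have h4 : Tendsto (fun r : ℝ => t - r.toNNReal) (𝓝[>] s) (𝓝 (t - s.toNNReal)) :=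
      (hsub.tendsto s).mono_left nhdsWithin_le_nhds
    refine (T.tendsto_op h4 h3).congr' ?_
    have h5 : ∀ᶠ r : ℝ in 𝓝[>] s, r < (t : ℝ) := nhdsWithin_le_nhds (gt_mem_nhds hs.2)
    filter_upwards [self_mem_nhdsWithin, h5] with r hr hrt
    have hr0 : 0 ≤ r := hs.1.trans (le_of_lt hr)
    have hr' : (0 : ℝ) ≤ r - s := (sub_pos.2 hr).le
    simp only [Function.comp, slope, vsub_eq_sub, u]
    rw [← smul_sub, map_smul]
    congr 1
    -- Once `T(t - r)` is factored out, `u r` and `u s` both start from `T'(s) f`, and the slope is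
    -- a difference of two difference quotients at time `0`.
    have e1 : r.toNNReal = (r - s).toNNReal + s.toNNReal := by
      rw [← Real.toNNReal_add hr' hs.1, sub_add_cancel]
    have e2 : t - s.toNNReal = (t - r.toNNReal) + (r - s).toNNReal := by
      have : r.toNNReal ≤ t := by
        rw [← Real.toNNReal_coe (r := t)]; exact Real.toNNReal_le_toNNReal hrt.le
      apply NNReal.coe_injective
      rw [NNReal.coe_add, NNReal.coe_sub hst, NNReal.coe_sub this, Real.coe_toNNReal _ hr0,
        Real.coe_toNNReal _ hr', Real.coe_toNNReal _ hs.1]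
      ring
    have e3 : T.op (t - s.toNNReal) (T'.op s.toNNReal f) =
        T.op (t - r.toNNReal) (T.op (r - s).toNNReal (T'.op s.toNNReal f)) := by
      rw [e2, T.op_add_apply]
    have e4 : T'.op r.toNNReal f = T'.op (r - s).toNNReal (T'.op s.toNNReal f) := by
      rw [e1, T'.op_add_apply]
    rw [e3, e4, ← map_sub]
    congr 1
    abel
  · have hst : s.toNNReal ≤ t := by
      rw [← Real.toNNReal_coe (r := t)]; exact Real.toNNReal_le_toNNReal hs.2.le
    exact (T.norm_op_le _ _).trans (hε _ hst)

theorem mem_graph_generator {T : MarkovSemigroup E} {p : C(E, ℝ) × C(E, ℝ)} :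
    p ∈ T.generator.graph ↔ T.HasGenerator p.1 p.2 := by
  rw [LinearPMap.mem_graph_iff]
  constructor
  · rintro ⟨y, hy, hy'⟩
    rw [← hy, ← hy']
    exact Classical.choose_spec y.2
  · intro h
    exact ⟨⟨p.1, p.2, h⟩, rfl, (Classical.choose_spec (⟨p.2, h⟩ : ∃ g, _)).unique h⟩

theorem hasGenerator_generator (T : MarkovSemigroup E) (f : T.generator.domain) :
    T.HasGenerator f (T.generator f) :=
  Classical.choose_spec f.2

theorem HasGenerator.generator_eq {T : MarkovSemigroup E} {f g : C(E, ℝ)}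
    (h : T.HasGenerator f g) (hf : f ∈ T.generator.domain) : T.generator ⟨f, hf⟩ = g :=
  (T.hasGenerator_generator ⟨f, hf⟩).unique h

/-- The semigroup is determined by its generator as soon as the domain is dense. -/
theorem op_eq_of_generator_eq {T T' : MarkovSemigroup E} (h : T.generator = T'.generator)
    (hd : Dense (T.generator.domain : Set C(E, ℝ))) (t : ℝ≥0) : T.op t = T'.op t := by
  have key : ∀ f g, T.HasGenerator f g ↔ T'.HasGenerator f g := fun f g => by
    rw [← mem_graph_generator (p := (f, g)), ← mem_graph_generator (p := (f, g)), h]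
  refine ContinuousLinearMap.coeFn_injective
    (Continuous.ext_on hd (T.op t).continuous (T'.op t).continuous fun f hf => ?_)
  obtain ⟨g, hg⟩ := hf
  -- Equal generators allow the comparison with `ε = 0`.
  have h1 := norm_op_sub_op_le (T := T') (T' := T) (f := f) (t := t) (ε := 0) fun s _ =>
    ⟨T.op s g, T.op s g, (key _ _).1 (hg.op s), hg.op s, by simp⟩
  rw [zero_mul] at h1
  exact sub_eq_zero.1 (norm_le_zero_iff.1 h1)

theorem eq_of_op_eq {T T' : MarkovSemigroup E} (h : ∀ t, T.op t = T'.op t) : T = T' := by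
  cases T; cases T'
  congr
  exact funext h

/-- A dense subspace that is invariant under the semigroup is a core. -/
theorem HasGenerator.mem_of_core {T : MarkovSemigroup E}
    {G : Submodule ℝ (C(E, ℝ) × C(E, ℝ))} (hG : IsClosed (G : Set (C(E, ℝ) × C(E, ℝ))))
    {D : Set C(E, ℝ)} (hD : Dense D)
    (h : ∀ f ∈ D, ∃ g, T.HasGenerator f g ∧ ∀ t, (T.op t f, T.op t g) ∈ G)
    {f g : C(E, ℝ)} (hfg : T.HasGenerator f g) : (f, g) ∈ G := by
  -- The time-integrated pair is defined for every `f ∈ C(E)` and depends continuously on it, so it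
  -- is enough to treat `f` in the dense set `D`.
  have h1 : ∀ t : ℝ, 0 < t → ∀ f, (∫ s in (0 : ℝ)..t, T.op s.toNNReal f,
      T.op t.toNNReal f - f) ∈ G := by
    intro t ht f
    have hc : Continuous fun f => (∫ s in (0 : ℝ)..t, T.op s.toNNReal f,
        T.op t.toNNReal f - f) := by
      refine Continuous.prodMk ?_ (by fun_prop)
      refine (LipschitzWith.of_dist_le_mul (K := t.toNNReal) fun f f' => ?_).continuous
      rw [dist_eq_norm, dist_eq_norm,
        ← intervalIntegral.integral_sub ((T.continuous_op_toNNReal _).intervalIntegrable _ _)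
        ((T.continuous_op_toNNReal _).intervalIntegrable _ _)]
      have := intervalIntegral.norm_integral_le_of_norm_le_const (a := 0) (b := t)
        (fun s _ => T.norm_op_sub_le s.toNNReal f f')
      rw [sub_zero, abs_of_pos ht] at this
      rw [Real.coe_toNNReal _ ht.le]
      linarith
    refine (hG.preimage hc).closure_subset_iff.2 ?_ (hD f)
    intro f hf
    obtain ⟨g, hg, hfgG⟩ := h f hf
    change (_, _) ∈ G
    have hci : Continuous fun s : ℝ => (T.op s.toNNReal f, T.op s.toNNReal g) :=
      (T.continuous_op_toNNReal _).prodMk (T.continuous_op_toNNReal _)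
    have e : (∫ s in (0 : ℝ)..t, T.op s.toNNReal f, T.op t.toNNReal f - f) =
        ∫ s in (0 : ℝ)..t, (T.op s.toNNReal f, T.op s.toNNReal g) := by
      rw [← hg.integral_eq ht.le]
      have hi := hci.intervalIntegrable (μ := volume) 0 t
      refine Prod.ext ?_ ?_
      · exact (ContinuousLinearMap.fst ℝ C(E, ℝ) C(E, ℝ)).intervalIntegral_comp_comm hi
      · exact (ContinuousLinearMap.snd ℝ C(E, ℝ) C(E, ℝ)).intervalIntegral_comp_comm hi
    rw [e]
    -- The closed convex set `G` contains the average of the orbit over `(0, t]`; being a subspace,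
    -- it contains `t` times this average, which is the integral.
    have h3 := G.convex.set_average_mem (μ := volume) (t := Ioc 0 t) hG (by simpa using ht)
      (by simp) (.of_forall fun s => hfgG s.toNNReal)
      (hci.integrableOn_Icc.mono_set Ioc_subset_Icc_self)
    rw [setAverage_eq, ← intervalIntegral.integral_of_le ht.le] at h3
    simpa [smul_smul, ht.ne', ht.le] using G.smul_mem t h3
  have h2 : Tendsto (fun t : ℝ => t⁻¹ • (∫ s in (0 : ℝ)..t, T.op s.toNNReal f,
      T.op t.toNNReal f - f)) (𝓝[>] 0) (𝓝 (f, g)) :=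
    (T.tendsto_average f).prodMk_nhds (hasGenerator_iff_real.1 hfg)
  refine hG.mem_of_tendsto h2 ?_
  filter_upwards [self_mem_nhdsWithin] with t ht
  exact G.smul_mem _ (h1 t ht f)

end MarkovSemigroup

/-! ### Exponentials of bounded operators as Poisson averages. -/

section Uniformization

variable {X : Type*} [NormedAddCommGroup X] [NormedSpace ℝ X] [CompleteSpace X]

/-- The operator `exp (a (P - 1))`. -/
noncomputable def expSubOne (P : X →L[ℝ] X) (a : ℝ) : X →L[ℝ] X :=
  NormedSpace.exp (a • (P - 1))

/-- Splitting off the commuting factor `exp (-a)` leaves Poisson weights. For `a ≥ 0` they are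
nonnegative, so positivity of `P` is inherited. -/
theorem hasSum_expSubOne (P : X →L[ℝ] X) (a : ℝ) (f : X) :
    HasSum (fun n : ℕ => (Real.exp (-a) * ((n.factorial : ℝ)⁻¹ * a ^ n)) • (P ^ n) f)
      (expSubOne P a f) := by
  have h1 : expSubOne P a = Real.exp (-a) • NormedSpace.exp (a • P) := by
    have hb : ∀ x : X →L[ℝ] X, x ∈ Metric.eball (0 : X →L[ℝ] X)
        (NormedSpace.expSeries ℝ (X →L[ℝ] X)).radius := fun x =>
      (NormedSpace.expSeries_radius_eq_top ℝ (X →L[ℝ] X)).symm ▸ edist_lt_top _ _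
    have e : a • (P - 1) = algebraMap ℝ (X →L[ℝ] X) (-a) + a • P := by
      rw [Algebra.algebraMap_eq_smul_one, smul_sub, neg_smul]; abel
    rw [expSubOne, e, NormedSpace.exp_add_of_commute_of_mem_ball (𝕂 := ℝ)
      (Algebra.commutes _ _) (hb _) (hb _), ← NormedSpace.algebraMap_exp_comm,
      ← Real.exp_eq_exp_ℝ, Algebra.algebraMap_eq_smul_one, smul_mul_assoc, one_mul]
  rw [h1]
  have h2 := (NormedSpace.exp_series_hasSum_exp' (𝕂 := ℝ) (a • P)).const_smul (Real.exp (-a))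
  have h3 := h2.mapL (ContinuousLinearMap.apply ℝ X f)
  refine h3.congr_fun fun n => ?_
  simp [smul_pow, smul_smul]

/-- The generating function of a Poisson number of steps with mean `a`, at `r`, is `exp (a (r -
1))`. With `ℓ` a difference of two evaluations, this transfers variation bounds from the steps to
the semigroup. -/
theorem abs_expSubOne_le (P : X →L[ℝ] X) {a r β : ℝ} (ha : 0 ≤ a)
    (ℓ : X →L[ℝ] ℝ) (f : X) (h : ∀ n : ℕ, |ℓ ((P ^ n) f)| ≤ r ^ n * β) :
    |ℓ (expSubOne P a f)| ≤ Real.exp (a * (r - 1)) * β := by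
  have h1 := (hasSum_expSubOne P a f).mapL ℓ
  have h2 : HasSum (fun n : ℕ => Real.exp (-a) * ((n.factorial : ℝ)⁻¹ * (a * r) ^ n) * β)
      (Real.exp (a * (r - 1)) * β) := by
    have := NormedSpace.exp_series_hasSum_exp' (𝕂 := ℝ) (a * r)
    rw [← Real.exp_eq_exp_ℝ] at this
    have h3 := (this.mul_left (Real.exp (-a))).mul_right β
    rw [← Real.exp_add] at h3
    rwa [show -a + a * r = a * (r - 1) by ring] at h3
  rw [← Real.norm_eq_abs, ← h1.tsum_eq]
  refine tsum_of_norm_bounded h2 fun n => ?_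
  rw [map_smul, smul_eq_mul, norm_mul, Real.norm_of_nonneg (by positivity), Real.norm_eq_abs,
    mul_pow]
  calc _ ≤ Real.exp (-a) * ((n.factorial : ℝ)⁻¹ * a ^ n) * (r ^ n * β) := by
        gcongr; exact h n
    _ = _ := by ring

theorem expSubOne_zero (P : X →L[ℝ] X) : expSubOne P 0 = ContinuousLinearMap.id ℝ X := by
  rw [expSubOne, zero_smul, NormedSpace.exp_zero]; rfl

theorem expSubOne_add (P : X →L[ℝ] X) (a b : ℝ) :
    expSubOne P (a + b) = (expSubOne P a).comp (expSubOne P b) := by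
  have hb : ∀ x : X →L[ℝ] X, x ∈ Metric.eball (0 : X →L[ℝ] X)
      (NormedSpace.expSeries ℝ (X →L[ℝ] X)).radius := fun x =>
    (NormedSpace.expSeries_radius_eq_top ℝ (X →L[ℝ] X)).symm ▸ edist_lt_top _ _
  rw [expSubOne, add_smul, NormedSpace.exp_add_of_commute_of_mem_ball (𝕂 := ℝ)
    (((Commute.refl (P - 1)).smul_left _).smul_right _) (hb _) (hb _)]
  rfl

theorem expSubOne_apply_of_fixed {P : X →L[ℝ] X} {f : X} (h : P f = f) (a : ℝ) :
    expSubOne P a f = f := by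
  have h0 : (P - 1) f = 0 := by simp [h]
  have h2 := (NormedSpace.exp_series_hasSum_exp' (𝕂 := ℝ) (a • (P - 1))).mapL
    (ContinuousLinearMap.apply ℝ X f)
  refine h2.unique ?_
  convert hasSum_single (0 : ℕ) fun n hn => ?_ using 1
  · simp
  · obtain ⟨k, rfl⟩ := Nat.exists_eq_succ_of_ne_zero hn
    have h3 : ((P - 1) ^ (k + 1)) f = 0 := by
      rw [pow_succ]
      change ((P - 1) ^ k) ((P - 1) f) = 0
      rw [h0, map_zero]
    rw [smul_pow]
    change (_ : ℝ) • (_ : ℝ) • ((P - 1) ^ (k + 1)) f = 0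
    rw [h3, smul_zero, smul_zero]

theorem hasDerivAt_expSubOne (P : X →L[ℝ] X) (f : X) (a : ℝ) :
    HasDerivAt (fun a => expSubOne P a f) (expSubOne P a (P f - f)) a := by
  simpa [expSubOne] using
    (hasDerivAt_exp_smul_const (𝕂 := ℝ) (P - 1) a).clm_apply (hasDerivAt_const a f)

end Uniformization

/-! ### Construction of Markov semigroups: limits and bounded generators. -/

namespace MarkovSemigroup

variable {E : Type*} [TopologicalSpace E] [CompactSpace E]

/-- A family of Markov semigroups that is Cauchy (locally uniformly in time) on a dense set
converges to a Markov semigroup. -/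
theorem exists_tendstoUniformlyOn {ι : Type*} {l : Filter ι} [l.NeBot]
    (U : ι → MarkovSemigroup E) {D : Set C(E, ℝ)} (hD : Dense D)
    (h : ∀ f ∈ D, ∀ t₀, UniformCauchySeqOn (fun i t => (U i).op t f) l (Iic t₀)) :
    ∃ T : MarkovSemigroup E, ∀ f t₀,
      TendstoUniformlyOn (fun i t => (U i).op t f) (fun t => T.op t f) l (Iic t₀) := by
  have hC : ∀ f t₀, UniformCauchySeqOn (fun i t => (U i).op t f) l (Iic t₀) := by
    intro f t₀ V hV
    obtain ⟨ε, hε, hεV⟩ := Metric.mem_uniformity_dist.1 hV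
    obtain ⟨g, hg, hfg⟩ := Metric.dense_iff.1 hD f (ε / 3) (by positivity)
    rw [Metric.mem_ball, dist_eq_norm] at hg
    filter_upwards [h g hfg t₀ _ (Metric.dist_mem_uniformity (show 0 < ε / 3 by positivity))]
      with ij hij t ht
    refine hεV ?_
    have h1 := hij t ht
    simp only [dist_eq_norm] at h1 ⊢
    have h2 := (U ij.1).norm_op_sub_le t f g
    have h3 := (U ij.2).norm_op_sub_le t g f
    rw [norm_sub_rev f g] at h2
    calc ‖(U ij.1).op t f - (U ij.2).op t f‖
        = ‖((U ij.1).op t f - (U ij.1).op t g) + ((U ij.1).op t g - (U ij.2).op t g) +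
          ((U ij.2).op t g - (U ij.2).op t f)‖ := by congr 1; abel
      _ ≤ _ := norm_add₃_le
      _ < ε := by linarith
  have hlim : ∀ f t, ∃ g, Tendsto (fun i => (U i).op t f) l (𝓝 g) := by
    intro f t
    refine CompleteSpace.complete (f := map (fun i => (U i).op t f) l) ?_
    refine cauchy_map_iff.2 ⟨inferInstance, fun V hV => ?_⟩
    exact (hC f t V hV).mono fun ij hij => hij t (mem_Iic.2 le_rfl)
  choose L hL using hlim
  let op (t : ℝ≥0) : C(E, ℝ) →L[ℝ] C(E, ℝ) := LinearMap.mkContinuous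
    { toFun := fun f => L f t
      map_add' := fun f g => tendsto_nhds_unique (hL (f + g) t)
        (by simpa only [map_add] using (hL f t).add (hL g t))
      map_smul' := fun a f => tendsto_nhds_unique (hL (a • f) t)
        (by simpa only [map_smul, RingHom.id_apply] using (hL f t).const_smul a) } 1
    (fun f => by
      rw [one_mul]
      exact le_of_tendsto (hL f t).norm (.of_forall fun i => (U i).norm_op_le t f))
  have hop : ∀ f t, Tendsto (fun i => (U i).op t f) l (𝓝 (op t f)) := hL
  have hunif : ∀ f t₀,
      TendstoUniformlyOn (fun i t => (U i).op t f) (fun t => op t f) l (Iic t₀) :=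
    fun f t₀ => (hC f t₀).tendstoUniformlyOn_of_tendsto fun t _ => hop f t
  refine ⟨⟨op, ?_, ?_, ?_, ?_, ?_⟩, hunif⟩
  · ext1 f
    refine tendsto_nhds_unique (hop f 0) ?_
    simp only [op_zero_apply]
    exact tendsto_const_nhds
  · intro s t
    ext1 f
    refine tendsto_nhds_unique (hop f (s + t)) ?_
    simp only [op_add_apply]
    have h2 : Tendsto (fun i => (U i).op s ((U i).op t f) - (U i).op s (op t f)) l (𝓝 0) :=
      squeeze_zero_norm (fun i => (U i).norm_op_sub_le _ _ _)
        (by simpa using (tendsto_iff_norm_sub_tendsto_zero.1 (hop f t)))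
    simpa using h2.add (hop (op t f) s)
  · intro t f hf x
    have h1 : Tendsto (fun i => (U i).op t f x) l (𝓝 (op t f x)) :=
      ((ContinuousMap.evalCLM ℝ x).continuous.tendsto _).comp (hop f t)
    exact ge_of_tendsto h1 (.of_forall fun i => (U i).op_nonneg t f hf x)
  · intro t
    refine tendsto_nhds_unique (hop 1 t) ?_
    simp only [op_one]
    exact tendsto_const_nhds
  · intro f
    refine continuous_iff_continuousAt.2 fun t => ?_
    have h1 : ContinuousOn (fun t => op t f) (Iic (t + 1)) :=
      (hunif f (t + 1)).continuousOn (.of_forall fun i => ((U i).continuous_op f).continuousOn)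
    exact h1.continuousAt (Iic_mem_nhds (lt_add_one t))

/-- The Markov semigroup `exp (t m (P - 1))`, where `P` is positive and `P 1 = 1`. -/
noncomputable def ofPositive (P : C(E, ℝ) →L[ℝ] C(E, ℝ)) (hP : ∀ f, 0 ≤ f → 0 ≤ P f)
    (hP1 : P 1 = 1) (m : ℝ≥0) : MarkovSemigroup E where
  op t := expSubOne P (t * m)
  op_zero := by rw [NNReal.coe_zero, zero_mul, expSubOne_zero]
  op_add s t := by rw [NNReal.coe_add, add_mul, expSubOne_add]
  op_nonneg t f hf x := by
    have h1 := (hasSum_expSubOne P (t * m) f).mapL (ContinuousMap.evalCLM ℝ x)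
    refine h1.nonneg fun n => ?_
    have h2 : 0 ≤ (P ^ n) f := by
      induction n with
      | zero => simpa using hf
      | succ n ih => rw [pow_succ']; exact hP _ ih
    have h3 : 0 ≤ ((P ^ n) f) x := h2 x
    rw [map_smul, smul_eq_mul]
    exact mul_nonneg (by positivity) h3
  op_one t := expSubOne_apply_of_fixed hP1 _
  continuous_op f := by
    have h1 : Continuous fun s : ℝ => expSubOne P s f :=
      continuous_iff_continuousAt.2 fun s => (hasDerivAt_expSubOne P f s).continuousAt
    exact h1.comp (by fun_prop : Continuous fun t : ℝ≥0 => (t * m : ℝ))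

theorem hasGenerator_ofPositive (P : C(E, ℝ) →L[ℝ] C(E, ℝ)) (hP : ∀ f, 0 ≤ f → 0 ≤ P f)
    (hP1 : P 1 = 1) (m : ℝ≥0) (f : C(E, ℝ)) :
    (ofPositive P hP hP1 m).HasGenerator f ((m : ℝ) • (P f - f)) := by
  have h0 := hasDerivAt_expSubOne P f ((0 : ℝ) * m)
  have h1 := HasDerivAt.scomp (0 : ℝ) h0 ((hasDerivAt_id (0 : ℝ)).mul_const (m : ℝ))
  have h2 := (hasDerivAt_iff_tendsto_slope_zero.1 h1).mono_left
    (nhdsWithin_mono 0 (fun x (hx : x ∈ Ioi (0 : ℝ)) => ne_of_gt hx))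
  rw [hasGenerator_iff_real]
  simp only [zero_mul, one_mul, zero_add, expSubOne_zero, Function.comp, id,
    ContinuousLinearMap.id_apply] at h2
  refine h2.congr' ?_
  filter_upwards [self_mem_nhdsWithin] with h hh
  have hh' : 0 ≤ h := le_of_lt hh
  simp [ofPositive, Real.coe_toNNReal h hh']

end MarkovSemigroup

/-! ### Variations at the sites and the Banach space `D`. -/

namespace IPS

section Variation

variable {W S : Type*} [TopologicalSpace W] [CompactSpace W]

theorem variation_le_iff {f : C(S → W, ℝ)} {x : S} {a : ℝ≥0∞} :
    variation f x ≤ a ↔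
      ∀ η ζ : S → W, (∀ y, y ≠ x → η y = ζ y) → ENNReal.ofReal |f η - f ζ| ≤ a := by
  simp only [variation, iSup_le_iff]

theorem le_variation (f : C(S → W, ℝ)) {x : S} {η ζ : S → W} (h : ∀ y, y ≠ x → η y = ζ y) :
    ENNReal.ofReal |f η - f ζ| ≤ variation f x :=
  variation_le_iff.1 le_rfl η ζ h

theorem variation_le_norm (f : C(S → W, ℝ)) (x : S) :
    variation f x ≤ ENNReal.ofReal (2 * ‖f‖) := by
  refine variation_le_iff.2 fun η ζ _ => ENNReal.ofReal_le_ofReal ?_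
  have h1 := f.norm_coe_le_norm η
  have h2 := f.norm_coe_le_norm ζ
  rw [Real.norm_eq_abs] at h1 h2
  linarith [abs_sub (f η) (f ζ)]

theorem variation_neg (f : C(S → W, ℝ)) (x : S) : variation (-f) x = variation f x := by
  have := variation_smul (-1) f x
  simpa using this

theorem variation_sub_le (f g : C(S → W, ℝ)) (x : S) :
    variation (f - g) x ≤ variation f x + variation g x := by
  rw [sub_eq_add_neg, ← variation_neg g]
  exact variation_add_le f (-g) x

theorem variation_le_add_sub (f g : C(S → W, ℝ)) (x : S) :
    variation f x ≤ variation g x + variation (f - g) x := by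
  simpa using variation_add_le g (f - g) x

theorem variation_mul_le (f g : C(S → W, ℝ)) (x : S) :
    variation (f * g) x ≤
      ENNReal.ofReal ‖f‖ * variation g x + ENNReal.ofReal ‖g‖ * variation f x := by
  refine variation_le_iff.2 fun η ζ h => ?_
  calc ENNReal.ofReal |(f * g) η - (f * g) ζ|
      ≤ ENNReal.ofReal (‖f‖ * |g η - g ζ| + ‖g‖ * |f η - f ζ|) := by
        refine ENNReal.ofReal_le_ofReal ?_
        have : (f * g) η - (f * g) ζ = f η * (g η - g ζ) + g ζ * (f η - f ζ) := by
          simp only [ContinuousMap.mul_apply]; ring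
        rw [this]
        refine (abs_add_le _ _).trans ?_
        rw [abs_mul, abs_mul]
        gcongr
        · exact f.norm_coe_le_norm η
        · exact g.norm_coe_le_norm ζ
    _ = ENNReal.ofReal ‖f‖ * ENNReal.ofReal |g η - g ζ| +
        ENNReal.ofReal ‖g‖ * ENNReal.ofReal |f η - f ζ| := by
        rw [ENNReal.ofReal_add (by positivity) (by positivity),
          ENNReal.ofReal_mul (norm_nonneg _), ENNReal.ofReal_mul (norm_nonneg _)]
    _ ≤ _ := by
        gcongr
        · exact le_variation g h
        · exact le_variation f h

theorem variation_comp_le {L : ℝ≥0} {φ : ℝ → ℝ} {K : Set ℝ} (hφ : LipschitzOnWith L φ K)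
    {f g : C(S → W, ℝ)} (hf : ∀ η, f η ∈ K) (hg : ∀ η, g η = φ (f η)) (x : S) :
    variation g x ≤ L * variation f x := by
  refine variation_le_iff.2 fun η ζ h => ?_
  have h1 := hφ.dist_le_mul _ (hf η) _ (hf ζ)
  rw [Real.dist_eq, Real.dist_eq, ← hg, ← hg] at h1
  refine (ENNReal.ofReal_le_ofReal h1).trans ?_
  rw [ENNReal.ofReal_mul L.coe_nonneg, ENNReal.ofReal_coe_nnreal]
  gcongr
  exact le_variation f h

/-- A supremum of continuous functions of `f`. Through it bounds on `tripleNorm` survive sup norm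
limits, on which completeness of `D` rests. -/
theorem lowerSemicontinuous_variation (x : S) :
    LowerSemicontinuous fun f : C(S → W, ℝ) => variation f x := by
  refine lowerSemicontinuous_iSup fun η => lowerSemicontinuous_iSup fun ζ =>
    lowerSemicontinuous_iSup fun h => Continuous.lowerSemicontinuous ?_
  exact ENNReal.continuous_ofReal.comp
    (((ContinuousMap.evalCLM ℝ η).continuous.sub (ContinuousMap.evalCLM ℝ ζ).continuous).abs)

theorem lowerSemicontinuous_tripleNorm :
    LowerSemicontinuous (tripleNorm : C(S → W, ℝ) → ℝ≥0∞) :=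
  lowerSemicontinuous_tsum lowerSemicontinuous_variation

/-- The coordinates in `F` are changed one at a time. This is how bounds at single sites control a
jump on a finite set. -/
theorem abs_sub_le_sum {b : S → ℝ} {f : C(S → W, ℝ)}
    (hf : ∀ x, ∀ η ζ : S → W, (∀ y, y ≠ x → η y = ζ y) → |f η - f ζ| ≤ b x) (F : Finset S)
    {η ζ : S → W} (h : ∀ y, y ∉ F → η y = ζ y) : |f η - f ζ| ≤ ∑ x ∈ F, b x := by
  classical
  induction F using Finset.induction_on generalizing η with
  | empty =>
    have : η = ζ := funext fun y => h y (by simp)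
    simp [this]
  | insert x F hx ih =>
    rw [Finset.sum_insert hx]
    refine (abs_sub_le _ (f (Function.update η x (ζ x))) _).trans (add_le_add ?_ ?_)
    · exact hf x _ _ fun y hy => by simp [hy]
    · refine ih fun y hy => ?_
      by_cases hyx : y = x
      · subst hyx; simp
      · simp only [ne_eq, hyx, not_false_eq_true, Function.update_of_ne]
        exact h y (by simp [hyx, hy])

end Variation

namespace TestSpace

section Topological

variable {W S : Type*} [TopologicalSpace W] [CompactSpace W]

theorem tripleNorm_lt_top (f : TestSpace W S) : tripleNorm (incl W S f) < ⊤ := f.2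

/-- An element of `C(E)` with finite triple norm, as an element of the space `D`. -/
def ofFinite (f : C(S → W, ℝ)) (hf : tripleNorm f < ⊤) : TestSpace W S := ⟨f, hf⟩

@[simp] theorem incl_ofFinite (f : C(S → W, ℝ)) (hf : tripleNorm f < ⊤) :
    incl W S (ofFinite f hf) = f := rfl

theorem incl_injective : Function.Injective (incl W S) := Subtype.val_injective

theorem norm_def (f : TestSpace W S) :
    ‖f‖ = (tripleNorm (incl W S f)).toReal + ‖incl W S f‖ := rfl

theorem norm_incl_le (f : TestSpace W S) : ‖incl W S f‖ ≤ ‖f‖ := by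
  rw [norm_def]; linarith [ENNReal.toReal_nonneg (a := tripleNorm (incl W S f))]

theorem toReal_tripleNorm_le (f : TestSpace W S) : (tripleNorm (incl W S f)).toReal ≤ ‖f‖ := by
  rw [norm_def]; linarith [norm_nonneg (incl W S f)]

theorem continuous_incl : Continuous (incl W S) :=
  (LinearMap.mkContinuous (incl W S) 1 fun f => by simpa using norm_incl_le f).continuous

theorem tripleNorm_le_ofReal (f : TestSpace W S) :
    tripleNorm (incl W S f) ≤ ENNReal.ofReal ‖f‖ := by
  rw [← ENNReal.ofReal_toReal (tripleNorm_lt_top f).ne]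
  exact ENNReal.ofReal_le_ofReal (toReal_tripleNorm_le f)

theorem tendsto_iff {ι : Type*} {l : Filter ι} {u : ι → TestSpace W S} {f : TestSpace W S} :
    Tendsto u l (𝓝 f) ↔ Tendsto (fun i => tripleNorm (incl W S (u i - f))) l (𝓝 0) ∧
      Tendsto (fun i => incl W S (u i)) l (𝓝 (incl W S f)) := by
  constructor
  · intro h
    refine ⟨?_, (continuous_incl.tendsto f).comp h⟩
    have h1 := ENNReal.tendsto_ofReal (tendsto_iff_norm_sub_tendsto_zero.1 h)
    rw [ENNReal.ofReal_zero] at h1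
    exact tendsto_of_tendsto_of_tendsto_of_le_of_le tendsto_const_nhds h1 (fun _ => zero_le)
      fun i => tripleNorm_le_ofReal _
  · rintro ⟨h1, h2⟩
    rw [tendsto_iff_norm_sub_tendsto_zero]
    have h3 := (ENNReal.tendsto_toReal ENNReal.zero_ne_top).comp h1
    have h4 := tendsto_iff_norm_sub_tendsto_zero.1 h2
    simpa [norm_def, map_sub] using h3.add h4

/-- Dominated convergence in the space `D`. -/
theorem tendsto_of_dominated {ι : Type*} {l : Filter ι} {u : ι → TestSpace W S}
    {f : TestSpace W S} {a : S → ℝ≥0∞} {b : ι → S → ℝ≥0∞}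
    (h : Tendsto (fun i => incl W S (u i)) l (𝓝 (incl W S f)))
    (hab : ∀ᶠ i in l, ∀ x, variation (incl W S (u i)) x ≤ a x + b i x)
    (ha : ∑' x, a x ≠ ⊤) (hb : Tendsto (fun i => ∑' x, b i x) l (𝓝 0)) :
    Tendsto u l (𝓝 f) := by
  refine tendsto_iff.2 ⟨?_, h⟩
  let A : S → ℝ≥0∞ := fun x => a x + variation (incl W S f) x
  have hA : ∑' x, A x ≠ ⊤ := by
    rw [ENNReal.tsum_add]
    exact ENNReal.add_ne_top.2 ⟨ha, (tripleNorm_lt_top f).ne⟩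
  have h0 := tendsto_iff_norm_sub_tendsto_zero.1 h
  refine ENNReal.tendsto_nhds_zero.2 fun ε hε => ?_
  have hε3 : 0 < ε / 3 := ENNReal.div_pos hε.ne' (by simp)
  obtain ⟨F, hF⟩ := (ENNReal.tendsto_nhds_zero.1
    (ENNReal.tendsto_tsum_compl_atTop_zero hA) _ hε3).exists
  have h1 : Tendsto (fun i => (F.card : ℝ≥0∞) *
      ENNReal.ofReal (2 * ‖incl W S (u i) - incl W S f‖)) l (𝓝 0) := by
    have h2 := ENNReal.tendsto_ofReal (h0.const_mul 2)
    rw [mul_zero, ENNReal.ofReal_zero] at h2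
    have h3 := ENNReal.Tendsto.const_mul (a := (F.card : ℝ≥0∞)) h2
      (Or.inr (ENNReal.natCast_ne_top _))
    rwa [mul_zero] at h3
  filter_upwards [hab, ENNReal.tendsto_nhds_zero.1 hb _ hε3,
    ENNReal.tendsto_nhds_zero.1 h1 _ hε3] with i hi1 hi2 hi3
  rw [map_sub]
  -- On the finite set `F` the sup norm controls each variation; off `F` the domination hypothesis
  -- leaves the tail of `A` and the vanishing `b i`.
  have h4 : ∀ x, variation (incl W S (u i) - incl W S f) x ≤
      (F : Set S).indicator (fun _ => ENNReal.ofReal (2 * ‖incl W S (u i) - incl W S f‖)) x +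
      ((F : Set S)ᶜ.indicator A x + b i x) := by
    intro x
    by_cases hx : x ∈ F
    · refine le_add_right ?_
      rw [indicator_of_mem (by simpa using hx)]
      exact variation_le_norm _ x
    · rw [indicator_of_notMem (by simpa using hx), indicator_of_mem (by simpa using hx), zero_add]
      refine (variation_sub_le _ _ x).trans ((add_le_add_left (hi1 x) _).trans_eq ?_)
      simp only [A]; ring
  calc tripleNorm (incl W S (u i) - incl W S f)
      ≤ ∑' x, ((F : Set S).indicator
          (fun _ => ENNReal.ofReal (2 * ‖incl W S (u i) - incl W S f‖)) x +
          ((F : Set S)ᶜ.indicator A x + b i x)) := ENNReal.tsum_le_tsum h4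
    _ = F.card * ENNReal.ofReal (2 * ‖incl W S (u i) - incl W S f‖) +
          (∑' x : {x // x ∉ F}, A x + ∑' x, b i x) := by
        rw [ENNReal.tsum_add, ENNReal.tsum_add]
        congr 1
        · rw [tsum_eq_sum (s := F) fun x hx => indicator_of_notMem (by simpa using hx) _,
            Finset.sum_congr rfl fun x hx => indicator_of_mem (by simpa using hx) _]
          simp
        · congr 1
          exact (tsum_subtype ((F : Set S)ᶜ) A).symm
    _ ≤ ε / 3 + (ε / 3 + ε / 3) := add_le_add hi3 (add_le_add hF hi2)
    _ = ε := by rw [← add_assoc, ENNReal.add_thirds]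

/-- The sup norm limit is the candidate; lower semicontinuity of `tripleNorm` carries the Cauchy
estimate over to it. -/
instance : CompleteSpace (TestSpace W S) := by
  refine Metric.complete_of_cauchySeq_tendsto fun u hu => ?_
  have h1 : CauchySeq fun n => incl W S (u n) :=
    (LinearMap.mkContinuous (incl W S) 1 fun f => by
      simpa using norm_incl_le f).uniformContinuous.comp_cauchySeq hu
  obtain ⟨f, hf⟩ := cauchySeq_tendsto_of_complete h1
  have h2 : ∀ ε : ℝ, 0 < ε → ∃ N, ∀ n ≥ N,
      tripleNorm (f - incl W S (u n)) ≤ ENNReal.ofReal ε := by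
    intro ε hε
    obtain ⟨N, hN⟩ := Metric.cauchySeq_iff.1 hu ε hε
    refine ⟨N, fun n hn => ?_⟩
    have hc : IsClosed {g : C(S → W, ℝ) | tripleNorm g ≤ ENNReal.ofReal ε} :=
      lowerSemicontinuous_tripleNorm.isClosed_preimage _
    refine hc.mem_of_tendsto (hf.sub_const (incl W S (u n))) ?_
    filter_upwards [eventually_ge_atTop N] with m hm
    have h3 := hN m hm n hn
    rw [dist_eq_norm] at h3
    rw [← map_sub]
    exact (tripleNorm_le_ofReal _).trans (ENNReal.ofReal_le_ofReal h3.le)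
  have hfm : tripleNorm f < ⊤ := by
    obtain ⟨N, hN⟩ := h2 1 one_pos
    have := tripleNorm_add_le (f - incl W S (u N)) (incl W S (u N))
    rw [sub_add_cancel] at this
    exact this.trans_lt (ENNReal.add_lt_top.2
      ⟨(hN N le_rfl).trans_lt ENNReal.ofReal_lt_top, tripleNorm_lt_top _⟩)
  refine ⟨ofFinite f hfm, tendsto_iff.2 ⟨ENNReal.tendsto_nhds_zero.2 fun ε hε => ?_, hf⟩⟩
  obtain ⟨r, hr0, hr⟩ := ENNReal.lt_iff_exists_real_btwn.1 hε
  obtain ⟨N, hN⟩ := h2 r (by simpa using hr.1)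
  filter_upwards [eventually_ge_atTop N] with n hn
  refine le_trans ?_ ((hN n hn).trans hr.2.le)
  rw [map_sub, incl_ofFinite]
  refine ENNReal.tsum_le_tsum fun x => ?_
  rw [← variation_neg, neg_sub]

/-- Multiplication in `D`. -/
theorem exists_mul : ∃ F : TestSpace W S × TestSpace W S → TestSpace W S,
    (∀ p, incl W S (F p) = incl W S p.1 * incl W S p.2) ∧ Continuous F := by
  have h : ∀ f g : TestSpace W S, tripleNorm (incl W S f * incl W S g) ≤
      ENNReal.ofReal ‖incl W S f‖ * tripleNorm (incl W S g) +
      ENNReal.ofReal ‖incl W S g‖ * tripleNorm (incl W S f) := fun f g => by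
    rw [tripleNorm, tripleNorm, tripleNorm, ← ENNReal.tsum_mul_left, ← ENNReal.tsum_mul_left,
      ← ENNReal.tsum_add]
    exact ENNReal.tsum_le_tsum fun x => variation_mul_le _ _ x
  have hlt : ∀ f g : TestSpace W S, ENNReal.ofReal ‖incl W S f‖ * tripleNorm (incl W S g) +
      ENNReal.ofReal ‖incl W S g‖ * tripleNorm (incl W S f) < ⊤ := fun f g =>
    ENNReal.add_lt_top.2 ⟨ENNReal.mul_lt_top ENNReal.ofReal_lt_top (tripleNorm_lt_top _),
      ENNReal.mul_lt_top ENNReal.ofReal_lt_top (tripleNorm_lt_top _)⟩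
  let B : TestSpace W S →ₗ[ℝ] TestSpace W S →ₗ[ℝ] TestSpace W S := LinearMap.mk₂ ℝ
    (fun f g => ofFinite (incl W S f * incl W S g) ((h f g).trans_lt (hlt f g)))
    (fun f f' g => incl_injective (by simp [add_mul]))
    (fun a f g => incl_injective (by simp))
    (fun f g g' => incl_injective (by simp [mul_add]))
    (fun a f g => incl_injective (by simp))
  have hB : ∀ f g, ‖B f g‖ ≤ 1 * ‖f‖ * ‖g‖ := fun f g => by
    have h1 := ENNReal.toReal_mono (hlt f g).ne (h f g)
    rw [ENNReal.toReal_add (ENNReal.mul_lt_top ENNReal.ofReal_lt_top (tripleNorm_lt_top _)).ne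
      (ENNReal.mul_lt_top ENNReal.ofReal_lt_top (tripleNorm_lt_top _)).ne, ENNReal.toReal_mul,
      ENNReal.toReal_mul, ENNReal.toReal_ofReal (norm_nonneg _),
      ENNReal.toReal_ofReal (norm_nonneg _)] at h1
    have h2 := norm_mul_le (incl W S f) (incl W S g)
    -- The term of `‖f‖ * ‖g‖` that the product rule leaves over.
    have h3 : 0 ≤ (tripleNorm (incl W S f)).toReal * (tripleNorm (incl W S g)).toReal := by
      positivity
    change (tripleNorm (incl W S f * incl W S g)).toReal + ‖incl W S f * incl W S g‖ ≤ _
    rw [norm_def f, norm_def g]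
    linarith
  refine ⟨fun p => B.mkContinuous₂ 1 hB p.1 p.2, fun p => rfl, by fun_prop⟩

theorem exists_comp {L : ℝ≥0} {φ : ℝ → ℝ} (f : TestSpace W S)
    (hφ : LipschitzOnWith L φ (range (incl W S f))) :
    ∃ g : TestSpace W S, ∀ η, incl W S g η = φ (incl W S f η) := by
  let g : C(S → W, ℝ) := ⟨fun η => φ (incl W S f η),
    hφ.continuousOn.comp_continuous (incl W S f).continuous fun η => mem_range_self η⟩
  refine ⟨ofFinite g ?_, fun η => rfl⟩
  calc tripleNorm g ≤ ∑' x, L * variation (incl W S f) x :=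
        ENNReal.tsum_le_tsum fun x =>
          variation_comp_le hφ (f := incl W S f) (fun η => mem_range_self η) (fun η => rfl) x
    _ = L * tripleNorm (incl W S f) := ENNReal.tsum_mul_left
    _ < ⊤ := ENNReal.mul_lt_top ENNReal.coe_lt_top (tripleNorm_lt_top f)

/-- Composition with a Lipschitz function is continuous in `D`. -/
theorem tendsto_comp {L : ℝ≥0} {φ : ℝ → ℝ} {K : Set ℝ} (hφ : LipschitzOnWith L φ K)
    {ι : Type*} {l : Filter ι} {u v : ι → TestSpace W S} {f g : TestSpace W S}
    (hu : Tendsto u l (𝓝 f)) (huK : ∀ᶠ i in l, ∀ η, incl W S (u i) η ∈ K)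
    (hfK : ∀ η, incl W S f η ∈ K) (hv : ∀ i η, incl W S (v i) η = φ (incl W S (u i) η))
    (hg : ∀ η, incl W S g η = φ (incl W S f η)) : Tendsto v l (𝓝 g) := by
  obtain ⟨h1, h2⟩ := tendsto_iff.1 hu
  -- A Lipschitz `φ` does not in general bound the variations of `φ ∘ u i - φ ∘ f` by those of `u i
  -- - f`. Domination is enough: a fixed majorant from `f` and a vanishing one from `u i - f`.
  refine tendsto_of_dominated (a := fun x => L * variation (incl W S f) x)
    (b := fun i x => L * variation (incl W S (u i - f)) x) ?_ ?_ ?_ ?_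
  · rw [tendsto_iff_norm_sub_tendsto_zero] at h2 ⊢
    have h3 := h2.const_mul (L : ℝ)
    rw [mul_zero] at h3
    refine squeeze_zero' (.of_forall fun i => norm_nonneg _) ?_ h3
    filter_upwards [huK] with i hi
    refine (ContinuousMap.norm_le _ (by positivity)).2 fun η => ?_
    have h4 := hφ.dist_le_mul _ (hi η) _ (hfK η)
    rw [← hv, ← hg, dist_eq_norm, dist_eq_norm] at h4
    refine h4.trans ?_
    gcongr
    exact (incl W S (u i) - incl W S f).norm_coe_le_norm η
  · filter_upwards [huK] with i hi x
    refine (variation_comp_le hφ hi (hv i) x).trans ?_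
    rw [← mul_add, map_sub]
    gcongr
    exact variation_le_add_sub _ _ x
  · rw [ENNReal.tsum_mul_left]
    exact (ENNReal.mul_lt_top ENNReal.coe_lt_top (tripleNorm_lt_top f)).ne
  · simp_rw [ENNReal.tsum_mul_left]
    have h3 := ENNReal.Tendsto.const_mul (a := (L : ℝ≥0∞)) h1 (Or.inr ENNReal.coe_ne_top)
    rwa [mul_zero] at h3

end Topological

end TestSpace

end IPS

/-- Baire: multiples of the barrel cover the space, so the barrel has an interior point `y`, and `0`
is the midpoint of `y` and `-y`. -/
theorem IsBarrel.mem_nhds_zero {X : Type*} [NormedAddCommGroup X] [NormedSpace ℝ X]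
    [CompleteSpace X] {B : Set X} (hB : IsBarrel B) : B ∈ 𝓝 (0 : X) := by
  have h1 : ⋃ n : ℕ, ((n : ℝ) + 1) • B = univ := by
    refine eq_univ_of_forall fun x => ?_
    obtain ⟨r, hr⟩ := (absorbs_iff_norm.1 (hB.absorbent x))
    obtain ⟨n, hn⟩ := exists_nat_ge r
    refine mem_iUnion.2 ⟨n, hr ((n : ℝ) + 1) ?_ (mem_singleton x)⟩
    rw [Real.norm_of_nonneg (by positivity)]
    linarith
  obtain ⟨n, x, hx⟩ := nonempty_interior_of_iUnion_of_closed
    (fun n : ℕ => hB.isClosed.smul_of_ne_zero (Nat.cast_add_one_ne_zero (R := ℝ) n)) h1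
  have hn : (n : ℝ) + 1 ≠ 0 := Nat.cast_add_one_ne_zero n
  rw [interior_smul₀ hn] at hx
  obtain ⟨y, hy, -⟩ := hx
  have hy' : -y ∈ B := hB.balanced.neg_mem_iff.2 (interior_subset hy)
  have h0 : (0 : X) ∈ interior B := by
    have := hB.convex.combo_interior_self_mem_interior hy hy' (a := 1 / 2) (b := 1 / 2)
      (by norm_num) (by norm_num) (by norm_num)
    simpa using this
  exact mem_interior_iff_mem_nhds.1 h0

theorem isBarrel_closedBall {X : Type*} [NormedAddCommGroup X] [NormedSpace ℝ X] {r : ℝ}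
    (hr : 0 < r) : IsBarrel (Metric.closedBall (0 : X) r) where
  convex := convex_closedBall 0 r
  balanced := balanced_closedBall_zero
  absorbent := absorbent_nhds_zero (Metric.closedBall_mem_nhds 0 hr)
  isClosed := Metric.isClosed_closedBall

/-! ### Approximation by cylinder functions: density and separability of `D`. -/

namespace IPS

variable {W S : Type*}

open Classical in
/-- The configuration equal to `η` on `F` and to `o` off `F`, as a function of `η`. -/
noncomputable def patch [TopologicalSpace W] (o : S → W) (F : Finset S) :
    C(S → W, S → W) where
  toFun η x := if x ∈ F then η x else o x
  continuous_toFun := continuous_pi fun x => by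
    by_cases hx : x ∈ F
    · simpa [hx] using continuous_apply x
    · simpa [hx] using continuous_const

theorem patch_of_mem [TopologicalSpace W] {o : S → W} {F : Finset S} {x : S} (hx : x ∈ F)
    (η : S → W) : patch o F η x = η x := by simp [patch, hx]

theorem patch_of_notMem [TopologicalSpace W] {o : S → W} {F : Finset S} {x : S} (hx : x ∉ F)
    (η : S → W) : patch o F η x = o x := by simp [patch, hx]

theorem variation_comp_patch_of_notMem [TopologicalSpace W] [CompactSpace W] {o : S → W}
    {F : Finset S} {x : S} (hx : x ∉ F) (f : C(S → W, ℝ)) :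
    variation (f.comp (patch o F)) x = 0 := by
  refine le_antisymm (variation_le_iff.2 fun η ζ h => ?_) zero_le
  have : patch o F η = patch o F ζ := by
    funext y
    by_cases hy : y ∈ F
    · rw [patch_of_mem hy, patch_of_mem hy]
      exact h y fun e => hx (e ▸ hy)
    · rw [patch_of_notMem hy, patch_of_notMem hy]
  simp [this]

theorem variation_comp_patch_le [TopologicalSpace W] [CompactSpace W] (o : S → W)
    (F : Finset S) (x : S) (f : C(S → W, ℝ)) :
    variation (f.comp (patch o F)) x ≤ variation f x := by
  refine variation_le_iff.2 fun η ζ h => le_variation f fun y hy => ?_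
  by_cases hyF : y ∈ F
  · rw [patch_of_mem hyF, patch_of_mem hyF, h y hy]
  · rw [patch_of_notMem hyF, patch_of_notMem hyF]

theorem tripleNorm_comp_patch_lt_top [TopologicalSpace W] [CompactSpace W] (o : S → W)
    (F : Finset S) (f : C(S → W, ℝ)) : tripleNorm (f.comp (patch o F)) < ⊤ := by
  rw [tripleNorm, tsum_eq_sum (s := F) fun x hx => variation_comp_patch_of_notMem hx f]
  exact ENNReal.sum_lt_top.2 fun x _ => (variation_le_norm _ x).trans_lt ENNReal.ofReal_lt_top

section Uniform

variable [UniformSpace W] [CompactSpace W]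

/-- Each coordinate of `patch o F η` is eventually exact, so in the product uniformity the patches
converge to `η` uniformly in `η`; continuous functions on the compact `E` are uniformly continuous.
-/
theorem tendsto_comp_patch (o : S → W) (f : C(S → W, ℝ)) :
    Tendsto (fun F => f.comp (patch o F)) atTop (𝓝 f) := by
  rw [ContinuousMap.tendsto_iff_tendstoUniformly]
  have h1 : TendstoUniformly (fun (F : Finset S) (η : S → W) => patch o F η) id atTop := by
    rw [tendstoUniformly_iff_tendsto, Pi.uniformity, tendsto_iInf]
    intro x
    rw [tendsto_comap_iff]
    refine tendsto_def.2 fun V hV => ?_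
    have h2 : ∀ᶠ F : Finset S in atTop, x ∈ F := by
      filter_upwards [eventually_ge_atTop {x}] with F hF using hF (by simp)
    filter_upwards [h2.prod_inl (⊤ : Filter (S → W))] with p hp
    simp only [mem_preimage, Function.comp, id, patch_of_mem hp]
    exact refl_mem_uniformity hV
  exact (CompactSpace.uniformContinuous_of_continuous f.continuous).comp_tendstoUniformly h1

theorem denseRange_incl : DenseRange (TestSpace.incl W S) := by
  intro f
  rcases isEmpty_or_nonempty (S → W) with h | ⟨⟨o⟩⟩
  · rw [show f = TestSpace.incl W S 0 from ContinuousMap.ext fun η => h.elim η]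
    exact subset_closure (mem_range_self _)
  · exact mem_closure_of_tendsto (tendsto_comp_patch o f) (.of_forall fun F =>
      ⟨TestSpace.ofFinite _ (tripleNorm_comp_patch_lt_top o F f), rfl⟩)

namespace TestSpace

/-- Patching increases no variation, so the variations of `f` itself dominate. -/
theorem tendsto_patch (o : S → W) (f : TestSpace W S) :
    Tendsto (fun F => ofFinite _ (tripleNorm_comp_patch_lt_top o F (incl W S f))) atTop (𝓝 f) :=
  tendsto_of_dominated (a := variation (incl W S f)) (b := fun _ _ => 0)
    (tendsto_comp_patch o (incl W S f))
    (.of_forall fun F x => by simpa using variation_comp_patch_le o F x (incl W S f))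
    (tripleNorm_lt_top f).ne (by simp)

/-- Functions of the coordinates in `F`, as functions on `E`. -/
noncomputable def cylinder (F : Finset S) : C(F → W, ℝ) →ₗ[ℝ] C(S → W, ℝ) where
  toFun h := h.comp ⟨fun η x => η x, by fun_prop⟩
  map_add' _ _ := rfl
  map_smul' _ _ := rfl

theorem tripleNorm_cylinder_le (F : Finset S) (h : C(F → W, ℝ)) :
    tripleNorm (cylinder F h) ≤ F.card * ENNReal.ofReal (2 * ‖h‖) := by
  have h0 : ‖cylinder F h‖ ≤ ‖h‖ :=
    (ContinuousMap.norm_le _ (norm_nonneg _)).2 fun η => h.norm_coe_le_norm _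
  have h1 : ∀ x ∉ F, variation (cylinder F h) x = 0 := fun x hx => by
    refine le_antisymm (variation_le_iff.2 fun η ζ hηζ => ?_) zero_le
    have : (fun y : F => η y) = fun y : F => ζ y :=
      funext fun y => hηζ y fun e => hx (e ▸ y.2)
    change ENNReal.ofReal |h (fun y : F => η y) - h (fun y : F => ζ y)| ≤ 0
    simp [this]
  rw [tripleNorm, tsum_eq_sum h1, ← nsmul_eq_mul]
  refine Finset.sum_le_card_nsmul _ _ _ fun x _ => (variation_le_norm _ x).trans ?_
  exact ENNReal.ofReal_le_ofReal (by linarith)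

/-- For functions of finitely many coordinates the sup norm controls the norm of `D`, so
separability of `C(W^F)` passes to its image in `D`. -/
theorem exists_continuous_cylinder (F : Finset S) : ∃ Φ : C(F → W, ℝ) → TestSpace W S,
    Continuous Φ ∧ ∀ h, incl W S (Φ h) = cylinder F h := by
  have hlt : ∀ h : C(F → W, ℝ), tripleNorm (cylinder F h) < ⊤ := fun h =>
    (tripleNorm_cylinder_le F h).trans_lt
      (ENNReal.mul_lt_top (ENNReal.natCast_lt_top _) ENNReal.ofReal_lt_top)
  let Φ : C(F → W, ℝ) →ₗ[ℝ] TestSpace W S :=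
    { toFun := fun h => ofFinite (cylinder F h) (hlt h)
      map_add' := fun _ _ => rfl
      map_smul' := fun _ _ => rfl }
  refine ⟨Φ, (Φ.mkContinuous (F.card * 2 + 1) fun h => ?_).continuous, fun h => rfl⟩
  have h0 : ‖cylinder F h‖ ≤ ‖h‖ :=
    (ContinuousMap.norm_le _ (norm_nonneg _)).2 fun η => h.norm_coe_le_norm _
  have h1 := ENNReal.toReal_mono
    (ENNReal.mul_ne_top (ENNReal.natCast_ne_top _) ENNReal.ofReal_ne_top)
    (tripleNorm_cylinder_le F h)
  rw [ENNReal.toReal_mul, ENNReal.toReal_natCast, ENNReal.toReal_ofReal (by positivity)] at h1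
  change (tripleNorm (cylinder F h)).toReal + ‖cylinder F h‖ ≤ _
  linarith

end TestSpace

end Uniform

/-- Since `S` is countable, there are countably many `F`; the union of the separable ranges of `Φ F`
is dense because it contains every patched function. -/
instance TestSpace.separableSpace [MetricSpace W] [CompactSpace W] [Countable S] :
    TopologicalSpace.SeparableSpace (TestSpace W S) := by
  rcases isEmpty_or_nonempty (S → W) with h | ⟨⟨o⟩⟩
  · have : Subsingleton (TestSpace W S) := ⟨fun f g => incl_injective
      (ContinuousMap.ext fun η => h.elim η)⟩
    infer_instance
  choose Φ hΦ hΦ' using fun F : Finset S => exists_continuous_cylinder (W := W) F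
  have h1 : TopologicalSpace.IsSeparable (⋃ F : Finset S, range (Φ F)) :=
    .iUnion fun F => TopologicalSpace.isSeparable_range (hΦ F)
  rw [← TopologicalSpace.isSeparable_univ_iff]
  refine h1.closure.mono fun f _ => ?_
  refine mem_closure_of_tendsto (tendsto_patch o f) (.of_forall fun F => ?_)
  refine mem_iUnion.2 ⟨F, (incl W S f).comp ⟨fun ξ => modify o ξ, ?_⟩, incl_injective ?_⟩
  · exact continuous_pi fun x => by
      by_cases hx : x ∈ F
      · simpa [modify, hx] using continuous_apply (⟨x, hx⟩ : F)
      · simpa [modify, hx] using continuous_const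
  · rw [hΦ', incl_ofFinite]
    ext η
    change incl W S f (modify o fun x : F => η x) = incl W S f (patch o F η)
    congr 1

end IPS

/-! ### Total variation of a difference of finite measures. -/

section TotalVariation

variable {α : Type*} [MeasurableSpace α]

/-- The Jordan decomposition without subtraction, so that integrals of both sides can be compared.
The mass bounds come from evaluating the identity on the Hahn set, where `p` vanishes, and on its
complement, where `n` does. -/
theorem exists_add_eq_add_totalVariation (μ ν : Measure α) [IsFiniteMeasure μ]
    [IsFiniteMeasure ν] :
    ∃ p n : Measure α, IsFiniteMeasure p ∧ IsFiniteMeasure n ∧ μ + n = ν + p ∧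
      (μ.toSignedMeasure - ν.toSignedMeasure).totalVariation = p + n ∧
      p univ ≤ μ univ ∧ n univ ≤ ν univ := by
  let s := μ.toSignedMeasure - ν.toSignedMeasure
  let j := s.toJordanDecomposition
  have hj : j.posPart.toSignedMeasure - j.negPart.toSignedMeasure =
      μ.toSignedMeasure - ν.toSignedMeasure := s.toSignedMeasure_toJordanDecomposition
  have h1 : μ + j.negPart = ν + j.posPart := by
    rw [← Measure.toSignedMeasure_eq_toSignedMeasure_iff, Measure.toSignedMeasure_add,
      Measure.toSignedMeasure_add]
    rw [sub_eq_sub_iff_add_eq_add] at hj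
    rw [← hj, add_comm]
  obtain ⟨A, hA, -, -, hA1, hA2⟩ := j.exists_compl_positive_negative
  refine ⟨j.posPart, j.negPart, inferInstance, inferInstance, h1, rfl, ?_, ?_⟩
  · have h2 : (μ + j.negPart) Aᶜ = (ν + j.posPart) Aᶜ := by rw [h1]
    rw [Measure.add_apply, Measure.add_apply, hA2, add_zero] at h2
    rw [← measure_add_measure_compl (μ := j.posPart) hA, hA1, zero_add]
    calc j.posPart Aᶜ ≤ ν Aᶜ + j.posPart Aᶜ := le_add_self
      _ = μ Aᶜ := h2.symm
      _ ≤ μ univ := measure_mono (subset_univ _)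
  · have h2 : (μ + j.negPart) A = (ν + j.posPart) A := by rw [h1]
    rw [Measure.add_apply, Measure.add_apply, hA1, add_zero] at h2
    rw [← measure_add_measure_compl (μ := j.negPart) hA, hA2, add_zero]
    calc j.negPart A ≤ μ A + j.negPart A := le_add_self
      _ = ν A := h2
      _ ≤ ν univ := measure_mono (subset_univ _)

theorem totalVariation_sub_le (μ ν : Measure α) [IsFiniteMeasure μ] [IsFiniteMeasure ν] :
    (μ.toSignedMeasure - ν.toSignedMeasure).totalVariation univ ≤ μ univ + ν univ := by
  obtain ⟨p, n, _, _, _, h, hp, hn⟩ := exists_add_eq_add_totalVariation μ ν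
  rw [h, Measure.add_apply]
  exact add_le_add hp hn

theorem abs_integral_sub_integral_le (μ ν : Measure α) [IsFiniteMeasure μ] [IsFiniteMeasure ν]
    {g : α → ℝ} (hg : StronglyMeasurable g) {C : ℝ} (hC : ∀ x, |g x| ≤ C) :
    |∫ x, g x ∂μ - ∫ x, g x ∂ν| ≤
      C * ((μ.toSignedMeasure - ν.toSignedMeasure).totalVariation univ).toReal := by
  obtain ⟨p, n, _, _, h, hTV, _, _⟩ := exists_add_eq_add_totalVariation μ ν
  have hi : ∀ ρ : Measure α, IsFiniteMeasure ρ → Integrable g ρ := fun ρ _ =>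
    Integrable.of_bound hg.aestronglyMeasurable C (.of_forall hC)
  have h1 : ∫ x, g x ∂μ + ∫ x, g x ∂n = ∫ x, g x ∂ν + ∫ x, g x ∂p := by
    rw [← integral_add_measure (hi _ inferInstance) (hi _ inferInstance), h,
      integral_add_measure (hi _ inferInstance) (hi _ inferInstance)]
  have hb : ∀ ρ : Measure α, IsFiniteMeasure ρ → |∫ x, g x ∂ρ| ≤ C * (ρ univ).toReal :=
    fun ρ _ => norm_integral_le_of_norm_le_const (μ := ρ) (f := g) (C := C) (.of_forall hC)
  rw [hTV, Measure.add_apply, ENNReal.toReal_add (measure_ne_top _ _) (measure_ne_top _ _)]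
  have h2 := hb p inferInstance
  have h3 := hb n inferInstance
  calc |∫ x, g x ∂μ - ∫ x, g x ∂ν| = |∫ x, g x ∂p - ∫ x, g x ∂n| := by
        congr 1; linarith
    _ ≤ |∫ x, g x ∂p| + |∫ x, g x ∂n| := abs_sub _ _
    _ ≤ _ := by linarith

end TotalVariation

/-! ### Sums over finite sets of sites and superharmonic majorants. -/

namespace IPS

section Sums

variable {S : Type*}

theorem tsum_mul_sum_eq (r : Finset S → ℝ≥0∞) (a : S → ℝ≥0∞) :
    ∑' Λ : Finset S, r Λ * ∑ y ∈ Λ, a y = ∑' y, a y * ∑' Λ : {Λ : Finset S // y ∈ Λ}, r Λ := by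
  classical
  have h1 : ∀ Λ : Finset S, r Λ * ∑ y ∈ Λ, a y = ∑' y, if y ∈ Λ then r Λ * a y else 0 := by
    intro Λ
    rw [tsum_eq_sum (s := Λ) fun y hy => if_neg hy, Finset.mul_sum]
    exact Finset.sum_congr rfl fun y hy => (if_pos hy).symm
  have h2 : ∀ y, a y * ∑' Λ : {Λ : Finset S // y ∈ Λ}, r Λ =
      ∑' Λ : Finset S, if y ∈ Λ then r Λ * a y else 0 := by
    intro y
    rw [← ENNReal.tsum_mul_left]
    refine (tsum_subtype {Λ : Finset S | y ∈ Λ} fun Λ => a y * r Λ).trans ?_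
    refine tsum_congr fun Λ => ?_
    by_cases hy : y ∈ Λ
    · rw [if_pos hy, indicator_of_mem (by simpa using hy), mul_comm]
    · rw [if_neg hy, indicator_of_notMem (by simpa using hy)]
  simp_rw [h1, h2]
  exact ENNReal.tsum_comm

theorem tsum_mul_sum_le {r : Finset S → ℝ≥0∞} {C : ℝ≥0∞}
    (h : ∀ y, ∑' Λ : {Λ : Finset S // y ∈ Λ}, r Λ ≤ C) (a : S → ℝ≥0∞) :
    ∑' Λ : Finset S, r Λ * ∑ y ∈ Λ, a y ≤ C * ∑' y, a y := by
  rw [tsum_mul_sum_eq, ← ENNReal.tsum_mul_left]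
  exact ENNReal.tsum_le_tsum fun y => by rw [mul_comm]; exact mul_le_mul_left (h y) _

theorem tsum_eq_add_tsum_ne (g : S → ℝ≥0∞) (y : S) :
    ∑' x, g x = g y + ∑' u : {u : S // u ≠ y}, g u := by
  classical
  have h : ∑' u : {u : S // u ≠ y}, g u = ∑' x, if x = y then 0 else g x := by
    refine (tsum_subtype {u : S | u ≠ y} g).trans (tsum_congr fun x => ?_)
    by_cases hx : x = y <;> simp [hx]
  rw [h, ENNReal.tsum_eq_add_tsum_ite y]

/-- Superharmonic majorants of summable functions. -/
theorem exists_superharmonic {r : Finset S → S → ℝ≥0∞} {C : ℝ≥0∞} (hC : C ≠ ⊤)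
    (h : ∀ y, ∑' Λ : {Λ : Finset S // y ∈ Λ}, ∑' x, r Λ x ≤ C) (a : S → ℝ≥0∞) :
    ∃ b : S → ℝ≥0∞, a ≤ b ∧ ∑' x, b x ≤ 2 * ∑' x, a x ∧
      ∀ x, ∑' Λ : Finset S, r Λ x * ∑ y ∈ Λ, b y ≤ (2 * C + 1) * b x := by
  -- `G` has norm at most `C` on `ℓ¹(S)`, and the resolvent series `b = ∑ κ⁻ⁿ Gⁿ a` satisfies `G b ≤
  -- κ b`. As `κ ≥ 2 C`, its terms decay like `2⁻ⁿ`, whence the factor `2`; the summand `1` keeps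
  -- `κ` nonzero when `C = 0`.
  let G : (S → ℝ≥0∞) → S → ℝ≥0∞ := fun a x => ∑' Λ : Finset S, r Λ x * ∑ y ∈ Λ, a y
  let κ : ℝ≥0∞ := 2 * C + 1
  have hκ0 : κ ≠ 0 := by simp [κ]
  have hκt : κ ≠ ⊤ := by finiteness
  have hG : ∀ a, ∑' x, G a x ≤ C * ∑' x, a x := by
    intro a
    rw [ENNReal.tsum_comm]
    simp_rw [ENNReal.tsum_mul_right]
    exact tsum_mul_sum_le h a
  have hGn : ∀ n, ∑' x, (G^[n] a) x ≤ C ^ n * ∑' x, a x := by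
    intro n
    induction n with
    | zero => simp
    | succ n ih =>
      rw [Function.iterate_succ_apply', pow_succ', mul_assoc]
      exact (hG _).trans (mul_le_mul_right ih _)
  let b : S → ℝ≥0∞ := fun x => ∑' n : ℕ, κ⁻¹ ^ n * (G^[n] a) x
  refine ⟨b, fun x => ?_, ?_, fun x => ?_⟩
  · have := ENNReal.le_tsum (f := fun n : ℕ => κ⁻¹ ^ n * (G^[n] a) x) 0
    simpa using this
  · rw [ENNReal.tsum_comm]
    calc ∑' n : ℕ, ∑' x, κ⁻¹ ^ n * (G^[n] a) x ≤ ∑' n : ℕ, 2⁻¹ ^ n * ∑' x, a x := by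
          refine ENNReal.tsum_le_tsum fun n => ?_
          rw [ENNReal.tsum_mul_left]
          refine (mul_le_mul_right (hGn n) _).trans ?_
          rw [← mul_assoc, ← mul_pow]
          gcongr
          rw [mul_comm, ← div_eq_mul_inv]
          refine ENNReal.div_le_of_le_mul ?_
          rw [mul_add, ← mul_assoc, ENNReal.inv_mul_cancel (by simp) (by simp), one_mul]
          exact le_self_add
      _ = 2 * ∑' x, a x := by
          rw [ENNReal.tsum_mul_right, ENNReal.tsum_geometric, ENNReal.one_sub_inv_two, inv_inv]
  · have h1 : ∑' Λ : Finset S, r Λ x * ∑ y ∈ Λ, b y =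
        ∑' n : ℕ, κ⁻¹ ^ n * (G^[n + 1] a) x := by
      simp_rw [b, ← Summable.tsum_finsetSum fun _ _ => ENNReal.summable, ← Finset.mul_sum,
        ← ENNReal.tsum_mul_left]
      rw [ENNReal.tsum_comm]
      refine tsum_congr fun n => ?_
      rw [Function.iterate_succ_apply', ← ENNReal.tsum_mul_left]
      exact tsum_congr fun Λ => by ring
    rw [h1]
    calc ∑' n : ℕ, κ⁻¹ ^ n * (G^[n + 1] a) x
        = κ * ∑' n : ℕ, κ⁻¹ ^ (n + 1) * (G^[n + 1] a) x := by
          rw [← ENNReal.tsum_mul_left]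
          refine tsum_congr fun n => ?_
          rw [pow_succ', ← mul_assoc, ← mul_assoc, ENNReal.mul_inv_cancel hκ0 hκt, one_mul]
      _ ≤ κ * b x := by
          gcongr
          exact ENNReal.tsum_comp_le_tsum_of_injective (add_left_injective 1)
            fun n : ℕ => κ⁻¹ ^ n * (G^[n] a) x

end Sums

/-- `f` varies by at most `b x` with the coordinate at the site `x`. -/
def VarBound {W S : Type*} [TopologicalSpace W] (f : C(S → W, ℝ)) (b : S → ℝ) : Prop :=
  ∀ x, ∀ η ζ : S → W, (∀ y, y ≠ x → η y = ζ y) → |f η - f ζ| ≤ b x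

/-! ### The jump operator of a single set `Λ`. -/

section Rates

variable {W S : Type*} [MetricSpace W] [CompactSpace W] [MeasurableSpace W] [BorelSpace W]

theorem continuous_mass (c : Rates W S) (Λ : Finset S) :
    Continuous fun η => (c Λ η).mass :=
  FiniteMeasure.continuous_mass.comp (c Λ).continuous

theorem maxRate_lt_top (c : Rates W S) (Λ : Finset S) : maxRate c Λ < ⊤ := by
  obtain ⟨C, hC⟩ := (isCompact_range (continuous_mass c Λ)).bddAbove
  refine lt_of_le_of_lt (iSup_le fun η => ?_) (ENNReal.coe_lt_top (r := C))
  rw [← FiniteMeasure.ennreal_mass]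
  exact ENNReal.coe_le_coe.2 (hC (mem_range_self η))

/-- `c_Λ` as a real number. -/
noncomputable def rate (c : Rates W S) (Λ : Finset S) : ℝ≥0 := (maxRate c Λ).toNNReal

theorem coe_rate (c : Rates W S) (Λ : Finset S) : (rate c Λ : ℝ≥0∞) = maxRate c Λ :=
  ENNReal.coe_toNNReal (maxRate_lt_top c Λ).ne

theorem measureReal_le_rate (c : Rates W S) (Λ : Finset S) (η : S → W) :
    (c Λ η : Measure (Λ → W)).real univ ≤ rate c Λ := by
  have h : (c Λ η : Measure (Λ → W)) univ ≤ rate c Λ := by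
    rw [coe_rate]; exact le_iSup (fun η => (c Λ η : Measure (Λ → W)) univ) η
  exact ENNReal.toReal_mono (b := rate c Λ) ENNReal.coe_ne_top h

theorem rateDependence_le (c : Rates W S) (Λ : Finset S) (u : S) :
    rateDependence c Λ u ≤ 2 * maxRate c Λ := by
  refine iSup_le fun η => iSup_le fun η' => iSup_le fun _ => ?_
  refine (totalVariation_sub_le _ _).trans ?_
  rw [two_mul]
  exact add_le_add (le_iSup (fun η => (c Λ η : Measure (Λ → W)) univ) η)
    (le_iSup (fun η => (c Λ η : Measure (Λ → W)) univ) η')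

theorem rateDependence_lt_top (c : Rates W S) (Λ : Finset S) (u : S) :
    rateDependence c Λ u < ⊤ :=
  (rateDependence_le c Λ u).trans_lt (ENNReal.mul_lt_top (by simp) (maxRate_lt_top c Λ))

/-- The hypothesis on the dependence of the rates omits `u = x`; this term is at most `2 c_Λ`, and
the hypothesis on the total rates pays for it. -/
theorem tsum_rateDependence_le (c : Rates W S) (y : S) :
    ∑' Λ : {Λ : Finset S // y ∈ Λ}, ∑' x, rateDependence c Λ x ≤
      2 * (⨆ x : S, ∑' Λ : {Λ : Finset S // x ∈ Λ}, maxRate c Λ) +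
      ⨆ x : S, ∑' Λ : {Λ : Finset S // x ∈ Λ}, ∑' u : {u : S // u ≠ x}, rateDependence c Λ u := by
  have h1 : ∀ Λ : Finset S, ∑' x, rateDependence c Λ x ≤
      2 * maxRate c Λ + ∑' u : {u : S // u ≠ y}, rateDependence c Λ u := fun Λ => by
    rw [tsum_eq_add_tsum_ne (rateDependence c Λ) y]
    exact add_le_add (rateDependence_le c Λ y) le_rfl
  refine (ENNReal.tsum_le_tsum fun Λ : {Λ : Finset S // y ∈ Λ} => h1 Λ).trans ?_
  rw [ENNReal.tsum_add, ENNReal.tsum_mul_left]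
  exact add_le_add
    (mul_le_mul_right (le_iSup (fun x : S => ∑' Λ : {Λ : Finset S // x ∈ Λ}, maxRate c Λ) y) _)
    (le_iSup (fun x : S => ∑' Λ : {Λ : Finset S // x ∈ Λ}, ∑' u : {u : S // u ≠ x},
      rateDependence c Λ u) y)

theorem continuous_uncurry_modify (Λ : Finset S) :
    Continuous fun p : (S → W) × (Λ → W) => modify p.1 p.2 := by
  refine continuous_pi fun x => ?_
  by_cases h : x ∈ Λ
  · simpa [modify, h, Function.comp_def] using
      (continuous_apply (⟨x, h⟩ : Λ)).comp continuous_snd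
  · simpa [modify, h, Function.comp_def] using (continuous_apply x).comp continuous_fst

/-- Measure and integrand both move with `η`. Currying makes the integrand continuous in sup norm
while the masses stay bounded, so weak convergence is needed only against the integrand frozen at
`η₀`. -/
theorem continuous_jumpTerm (c : Rates W S) (f : C(S → W, ℝ)) (Λ : Finset S) :
    Continuous fun η => jumpTerm c f η Λ := by
  let F : C((S → W) × (Λ → W), ℝ) :=
    ⟨fun p => f (modify p.1 p.2) - f p.1,
      (f.continuous.comp (continuous_uncurry_modify Λ)).sub (f.continuous.comp continuous_fst)⟩
  refine continuous_iff_continuousAt.2 fun η₀ => ?_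
  have hi : ∀ η (g : C(Λ → W, ℝ)), Integrable g (c Λ η : Measure (Λ → W)) := fun η g =>
    g.continuous.integrable_of_hasCompactSupport (HasCompactSupport.of_compactSpace _)
  have h1 : Tendsto (fun η => ∫ ζ, F.curry η₀ ζ ∂(c Λ η : Measure (Λ → W))) (𝓝 η₀)
      (𝓝 (∫ ζ, F.curry η₀ ζ ∂(c Λ η₀ : Measure (Λ → W)))) :=
    FiniteMeasure.tendsto_iff_forall_integral_tendsto.1 ((c Λ).continuous.tendsto η₀)
      (BoundedContinuousFunction.mkOfCompact (F.curry η₀))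
  have h2 : Tendsto (fun η => ∫ ζ, (F.curry η - F.curry η₀) ζ ∂(c Λ η : Measure (Λ → W)))
      (𝓝 η₀) (𝓝 0) := by
    have h3 : Tendsto (fun η => ‖F.curry η - F.curry η₀‖ * rate c Λ) (𝓝 η₀) (𝓝 0) := by
      have := (tendsto_iff_norm_sub_tendsto_zero.1
        (F.curry.continuous.tendsto η₀)).mul_const (rate c Λ : ℝ)
      rwa [zero_mul] at this
    refine squeeze_zero_norm (fun η => ?_) h3
    refine (norm_integral_le_of_norm_le_const
      (.of_forall fun ζ => (F.curry η - F.curry η₀).norm_coe_le_norm ζ)).trans ?_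
    gcongr
    exact measureReal_le_rate c Λ η
  have h4 := h2.add h1
  rw [zero_add] at h4
  refine h4.congr fun η => ?_
  rw [← integral_add (hi _ _) (hi _ _)]
  refine integral_congr_ae (.of_forall fun ζ => ?_)
  simp [F]

theorem abs_jumpTerm_le (c : Rates W S) {f : C(S → W, ℝ)} {Λ : Finset S} {C : ℝ}
    (hC : ∀ η ζ : S → W, (∀ y, y ∉ Λ → η y = ζ y) → |f η - f ζ| ≤ C) (η : S → W) :
    |jumpTerm c f η Λ| ≤ rate c Λ * C := by
  have hC0 : 0 ≤ C := (abs_nonneg _).trans (hC η η fun _ _ => rfl)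
  have h : ∀ ζ : Λ → W, ‖f (modify η ζ) - f η‖ ≤ C := fun ζ =>
    hC _ _ fun y hy => by simp [modify, hy]
  refine (norm_integral_le_of_norm_le_const (.of_forall h)).trans ?_
  rw [mul_comm]
  gcongr
  exact measureReal_le_rate c Λ η

/-- The operator `f ↦ ∫ c_Λ(·, dζ) [f(·^ζ) - f(·)]` in `C(E)`. -/
noncomputable def jump (c : Rates W S) (Λ : Finset S) : C(S → W, ℝ) →L[ℝ] C(S → W, ℝ) :=
  LinearMap.mkContinuous
    { toFun := fun f => ⟨fun η => jumpTerm c f η Λ, continuous_jumpTerm c f Λ⟩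
      map_add' := fun f f' => by
        ext η
        simp only [ContinuousMap.coe_mk, ContinuousMap.add_apply, jumpTerm]
        rw [← integral_add (integrable_jump c f η Λ) (integrable_jump c f' η Λ)]
        congr 1
        funext ζ
        ring
      map_smul' := fun a f => by
        ext η
        simp only [ContinuousMap.coe_mk, ContinuousMap.smul_apply, jumpTerm, RingHom.id_apply,
          smul_eq_mul]
        rw [← integral_const_mul]
        congr 1
        funext ζ
        ring }
    (rate c Λ * 2) fun f => by
      refine (ContinuousMap.norm_le _ (by positivity)).2 fun η => ?_
      rw [mul_assoc]
      refine abs_jumpTerm_le c (fun η ζ _ => ?_) η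
      have h1 := f.norm_coe_le_norm η
      have h2 := f.norm_coe_le_norm ζ
      rw [Real.norm_eq_abs] at h1 h2
      linarith [abs_sub (f η) (f ζ)]

@[simp] theorem jump_apply (c : Rates W S) (Λ : Finset S) (f : C(S → W, ℝ)) (η : S → W) :
    jump c Λ f η = jumpTerm c f η Λ := rfl

theorem jump_one (c : Rates W S) (Λ : Finset S) : jump c Λ 1 = 0 := by
  ext η; simp [jumpTerm]

/-- This makes `1 + m⁻¹ ∑ jump` positive for large `m`: the gain is nonnegative and the loss rate is
at most `c_Λ`. -/
theorem neg_le_jump (c : Rates W S) (Λ : Finset S) {f : C(S → W, ℝ)} (hf : 0 ≤ f) (η : S → W) :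
    -(rate c Λ * f η) ≤ jump c Λ f η := by
  have h0 : ∀ ξ, 0 ≤ f ξ := hf
  have h1 : ∫ _ζ : Λ → W, -f η ∂(c Λ η : Measure (Λ → W)) ≤ jumpTerm c f η Λ :=
    integral_mono (integrable_const _) (integrable_jump c f η Λ) fun ζ => by
      have := h0 (modify η ζ)
      simp only
      linarith
  rw [integral_const, smul_eq_mul, mul_neg] at h1
  rw [jump_apply]
  have h2 := mul_le_mul_of_nonneg_right (measureReal_le_rate c Λ η) (h0 η)
  linarith

theorem norm_jump_le (c : Rates W S) (Λ : Finset S) {f : C(S → W, ℝ)} {b : S → ℝ}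
    (hf : VarBound f b) (hb : ∀ x, 0 ≤ b x) : ‖jump c Λ f‖ ≤ rate c Λ * ∑ y ∈ Λ, b y :=
  (ContinuousMap.norm_le _ (mul_nonneg (rate c Λ).2 (Finset.sum_nonneg fun y _ => hb y))).2
    fun η => abs_jumpTerm_le c (fun _ _ h => abs_sub_le_sum hf Λ h) η

/-- The added term compensates the loss part. There remain a change of configuration under one
measure, costing `b x` per unit of mass, and a change of measure for one integrand `G`, costing
total variation times `sup |G|`. -/
theorem abs_jump_sub_jump_le (c : Rates W S) (Λ : Finset S) {f : C(S → W, ℝ)} {b : S → ℝ}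
    (hf : VarBound f b) (hb : ∀ x, 0 ≤ b x) {x : S} {η η' : S → W}
    (h : ∀ y, y ≠ x → η y = η' y) :
    |jump c Λ f η - jump c Λ f η' + (c Λ η : Measure (Λ → W)).real univ * (f η - f η')| ≤
      (c Λ η : Measure (Λ → W)).real univ * b x +
        (rateDependence c Λ x).toReal * ∑ y ∈ Λ, b y := by
  have hi : ∀ η ξ : S → W,
      Integrable (fun ζ : Λ → W => f (modify ξ ζ)) (c Λ η : Measure (Λ → W)) := fun η ξ =>
    (f.continuous.comp (continuous_modify ξ)).integrable_of_hasCompactSupport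
      (HasCompactSupport.of_compactSpace _)
  let G : (Λ → W) → ℝ := fun ζ => f (modify η' ζ) - f η'
  have hG : ∀ ζ, |G ζ| ≤ ∑ y ∈ Λ, b y := fun ζ =>
    abs_sub_le_sum hf Λ fun y hy => by simp [modify, hy]
  have hGc : Continuous G := (f.continuous.comp (continuous_modify η')).sub continuous_const
  have h1 : jump c Λ f η - jump c Λ f η' +
      (c Λ η : Measure (Λ → W)).real univ * (f η - f η') =
      ∫ ζ, (f (modify η ζ) - f (modify η' ζ)) ∂(c Λ η : Measure (Λ → W)) +
      (∫ ζ, G ζ ∂(c Λ η : Measure (Λ → W)) - ∫ ζ, G ζ ∂(c Λ η' : Measure (Λ → W))) := by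
    simp only [jump_apply, jumpTerm, G]
    rw [integral_sub (hi η η) (integrable_const _), integral_sub (hi η η) (hi η η'),
      integral_sub (hi η η') (integrable_const _), integral_const, integral_const,
      smul_eq_mul, smul_eq_mul]
    ring
  rw [h1]
  refine (abs_add_le _ _).trans (add_le_add ?_ ?_)
  · rw [mul_comm]
    refine norm_integral_le_of_norm_le_const (μ := (c Λ η : Measure (Λ → W)))
      (f := fun ζ => f (modify η ζ) - f (modify η' ζ)) (C := b x) (.of_forall fun ζ => ?_)
    refine hf x _ _ fun y hy => ?_
    by_cases hyΛ : y ∈ Λ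
    · simp [modify, hyΛ]
    · simp [modify, hyΛ, h y hy]
  · refine (abs_integral_sub_integral_le (c Λ η : Measure (Λ → W))
      (c Λ η' : Measure (Λ → W)) hGc.stronglyMeasurable hG).trans ?_
    rw [mul_comm]
    refine mul_le_mul_of_nonneg_right ?_ (Finset.sum_nonneg fun y _ => hb y)
    refine ENNReal.toReal_mono (rateDependence_lt_top c Λ x).ne ?_
    exact le_iSup_of_le η (le_iSup_of_le η' (le_iSup (fun _ : ∀ y, y ≠ x → η y = η' y =>
      ((c Λ η : Measure (Λ → W)).toSignedMeasure -
        (c Λ η' : Measure (Λ → W)).toSignedMeasure).totalVariation univ) h))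

end Rates

end IPS

/-! ### Dynamics restricted to finitely many sets, with uniform variation bounds. -/

namespace IPS

section VarBound

variable {W S : Type*} [TopologicalSpace W] [CompactSpace W]

theorem varBound_variation (f : C(S → W, ℝ)) : VarBound f fun x => (variation f x).toReal := by
  intro x η ζ h
  rw [← ENNReal.ofReal_le_iff_le_toReal
    ((variation_le_norm f x).trans_lt ENNReal.ofReal_lt_top).ne]
  exact le_variation f h

theorem VarBound.variation_le {f : C(S → W, ℝ)} {b : S → ℝ} (h : VarBound f b) (x : S) :
    variation f x ≤ ENNReal.ofReal (b x) :=
  variation_le_iff.2 fun η ζ hηζ => ENNReal.ofReal_le_ofReal (h x η ζ hηζ)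

theorem VarBound.of_tendsto {ι : Type*} {l : Filter ι} [l.NeBot] {u : ι → C(S → W, ℝ)}
    {f : C(S → W, ℝ)} {b : S → ℝ} (hu : Tendsto u l (𝓝 f)) (h : ∀ i, VarBound (u i) b) :
    VarBound f b := by
  intro x η ζ hηζ
  have hc : Continuous fun g : C(S → W, ℝ) => |g η - g ζ| :=
    ((ContinuousMap.evalCLM ℝ η).continuous.sub (ContinuousMap.evalCLM ℝ ζ).continuous).abs
  exact le_of_tendsto ((hc.tendsto f).comp hu) (.of_forall fun i => h i x η ζ hηζ)

end VarBound

section Rates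

variable {W S : Type*} [MetricSpace W] [CompactSpace W] [MeasurableSpace W] [BorelSpace W]

/-- A bound for the total jump rate in a finite collection of finite sets. -/
noncomputable def totalRate (c : Rates W S) (F : Finset (Finset S)) : ℝ≥0 :=
  -- The summand `1` allows division by the rate even for empty `F`.
  1 + ∑ Λ ∈ F, rate c Λ

theorem totalRate_pos (c : Rates W S) (F : Finset (Finset S)) : (0 : ℝ) < totalRate c F := by
  rw [totalRate]; positivity

theorem sum_rate_le_totalRate (c : Rates W S) (F : Finset (Finset S)) :
    ∑ Λ ∈ F, (rate c Λ : ℝ) ≤ totalRate c F := by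
  rw [totalRate]; push_cast; linarith

/-- The transition operator of the discrete skeleton of the dynamics restricted to `F`. -/
noncomputable def finiteStep (c : Rates W S) (F : Finset (Finset S)) :
    C(S → W, ℝ) →L[ℝ] C(S → W, ℝ) :=
  ContinuousLinearMap.id ℝ _ + (totalRate c F : ℝ)⁻¹ • ∑ Λ ∈ F, jump c Λ

theorem finiteStep_apply (c : Rates W S) (F : Finset (Finset S)) (f : C(S → W, ℝ)) :
    finiteStep c F f = f + (totalRate c F : ℝ)⁻¹ • ∑ Λ ∈ F, jump c Λ f := by
  simp [finiteStep]

theorem finiteStep_apply_apply (c : Rates W S) (F : Finset (Finset S)) (f : C(S → W, ℝ))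
    (η : S → W) :
    finiteStep c F f η = f η + (totalRate c F : ℝ)⁻¹ * ∑ Λ ∈ F, jump c Λ f η := by
  rw [finiteStep_apply, ContinuousMap.add_apply, ContinuousMap.smul_apply, smul_eq_mul,
    ContinuousMap.sum_apply]

theorem finiteStep_nonneg (c : Rates W S) (F : Finset (Finset S)) (f : C(S → W, ℝ))
    (hf : 0 ≤ f) : 0 ≤ finiteStep c F f := by
  intro η
  have hm := totalRate_pos c F
  have h0 : 0 ≤ f η := hf η
  have h1 : -((totalRate c F : ℝ) * f η) ≤ ∑ Λ ∈ F, jump c Λ f η := by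
    calc -((totalRate c F : ℝ) * f η) ≤ -((∑ Λ ∈ F, (rate c Λ : ℝ)) * f η) :=
          neg_le_neg (mul_le_mul_of_nonneg_right (sum_rate_le_totalRate c F) h0)
      _ = ∑ Λ ∈ F, -(rate c Λ * f η) := by rw [Finset.sum_mul, Finset.sum_neg_distrib]
      _ ≤ _ := Finset.sum_le_sum fun Λ _ => neg_le_jump c Λ hf η
  change 0 ≤ finiteStep c F f η
  rw [finiteStep_apply_apply]
  have h2 := mul_le_mul_of_nonneg_left h1 (inv_nonneg.2 hm.le)
  rw [mul_neg, inv_mul_cancel_left₀ hm.ne'] at h2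
  linarith

theorem finiteStep_one (c : Rates W S) (F : Finset (Finset S)) : finiteStep c F 1 = 1 := by
  simp [finiteStep_apply, jump_one]

/-- Of the total rate `m`, the idle part `m - ∑ μ Λ` keeps the bound `b x`, the jumping part `∑ μ Λ`
costs `b x` again, and the dependence of the rates on the coordinate at `x` adds `κ b x`. Division
by `m` gives the factor. -/
theorem varBound_finiteStep (c : Rates W S) (F : Finset (Finset S)) {f : C(S → W, ℝ)}
    {b : S → ℝ} {κ : ℝ} (hf : VarBound f b) (hb : ∀ x, 0 ≤ b x)
    (hκ : ∀ x, ∑ Λ ∈ F, (rateDependence c Λ x).toReal * ∑ y ∈ Λ, b y ≤ κ * b x) :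
    VarBound (finiteStep c F f) fun x => (1 + κ / totalRate c F) * b x := by
  intro x η η' h
  have hm := totalRate_pos c F
  change |_ - _| ≤ (1 + κ / (totalRate c F : ℝ)) * b x
  obtain ⟨m, hmdef⟩ : ∃ m : ℝ, (totalRate c F : ℝ) = m := ⟨_, rfl⟩
  rw [hmdef] at hm ⊢
  let μ : Finset S → ℝ := fun Λ => (c Λ η : Measure (Λ → W)).real univ
  have hμ : ∑ Λ ∈ F, μ Λ ≤ m := hmdef ▸
    (Finset.sum_le_sum fun Λ _ => measureReal_le_rate c Λ η).trans (sum_rate_le_totalRate c F)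
  have h1 : |∑ Λ ∈ F, (jump c Λ f η - jump c Λ f η' + μ Λ * (f η - f η'))| ≤
      (∑ Λ ∈ F, μ Λ) * b x + κ * b x := by
    refine (Finset.abs_sum_le_sum_abs _ _).trans ?_
    refine (Finset.sum_le_sum fun Λ _ => abs_jump_sub_jump_le c Λ hf hb h).trans ?_
    rw [Finset.sum_add_distrib, Finset.sum_mul]
    exact add_le_add le_rfl (hκ x)
  have h2 : finiteStep c F f η - finiteStep c F f η' =
      m⁻¹ * ((m - ∑ Λ ∈ F, μ Λ) * (f η - f η') +
        ∑ Λ ∈ F, (jump c Λ f η - jump c Λ f η' + μ Λ * (f η - f η'))) := by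
    rw [finiteStep_apply_apply, finiteStep_apply_apply, Finset.sum_add_distrib,
      Finset.sum_sub_distrib, ← Finset.sum_mul, hmdef]
    field_simp
    ring
  rw [h2, abs_mul, abs_of_pos (inv_pos.2 hm)]
  have h3 : |(m - ∑ Λ ∈ F, μ Λ) * (f η - f η')| ≤ (m - ∑ Λ ∈ F, μ Λ) * b x := by
    rw [abs_mul, abs_of_nonneg (sub_nonneg.2 hμ)]
    exact mul_le_mul_of_nonneg_left (hf x η η' h) (sub_nonneg.2 hμ)
  calc m⁻¹ * |(m - ∑ Λ ∈ F, μ Λ) * (f η - f η') +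
        ∑ Λ ∈ F, (jump c Λ f η - jump c Λ f η' + μ Λ * (f η - f η'))|
      ≤ m⁻¹ * ((m - ∑ Λ ∈ F, μ Λ) * b x + ((∑ Λ ∈ F, μ Λ) * b x + κ * b x)) := by
        gcongr
        exact (abs_add_le _ _).trans (add_le_add h3 h1)
    _ = (1 + κ / m) * b x := by
        field_simp
        ring

/-- The semigroup of the dynamics restricted to `F`. -/
noncomputable def finiteSemigroup (c : Rates W S) (F : Finset (Finset S)) :
    MarkovSemigroup (S → W) :=
  .ofPositive (finiteStep c F) (finiteStep_nonneg c F) (finiteStep_one c F) (totalRate c F)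

theorem hasGenerator_finiteSemigroup (c : Rates W S) (F : Finset (Finset S))
    (f : C(S → W, ℝ)) : (finiteSemigroup c F).HasGenerator f (∑ Λ ∈ F, jump c Λ f) := by
  have h := MarkovSemigroup.hasGenerator_ofPositive (finiteStep c F) (finiteStep_nonneg c F)
    (finiteStep_one c F) (totalRate c F) f
  rwa [finiteStep_apply, add_sub_cancel_left, smul_smul,
    mul_inv_cancel₀ (totalRate_pos c F).ne', one_smul] at h

/-- The hypothesis on `b` is homogeneous, so the one-step bound iterates. A Poisson number of steps
with mean `t m` turns `(1 + κ/m) ^ n` into `exp (κ t)`, from which `m` has disappeared. -/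
theorem varBound_finiteSemigroup (c : Rates W S) (F : Finset (Finset S)) {f : C(S → W, ℝ)}
    {b : S → ℝ} {κ : ℝ} (hκ0 : 0 ≤ κ) (hf : VarBound f b) (hb : ∀ x, 0 ≤ b x)
    (hκ : ∀ x, ∑ Λ ∈ F, (rateDependence c Λ x).toReal * ∑ y ∈ Λ, b y ≤ κ * b x) (t : ℝ≥0) :
    VarBound ((finiteSemigroup c F).op t f) fun x => Real.exp (κ * t) * b x := by
  have hm := totalRate_pos c F
  have h1 : ∀ n : ℕ, VarBound ((finiteStep c F ^ n) f)
      fun x => (1 + κ / totalRate c F) ^ n * b x := by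
    intro n
    induction n with
    | zero => simpa using hf
    | succ n ih =>
      have h2 := varBound_finiteStep c F (κ := κ) ih (fun x => by have := hb x; positivity)
        fun x => by
          have h3 := mul_le_mul_of_nonneg_left (hκ x)
            (show 0 ≤ (1 + κ / totalRate c F) ^ n by positivity)
          rw [Finset.mul_sum] at h3
          calc _ = ∑ Λ ∈ F, (1 + κ / totalRate c F) ^ n *
                ((rateDependence c Λ x).toReal * ∑ y ∈ Λ, b y) :=
                Finset.sum_congr rfl fun Λ _ => by rw [← Finset.mul_sum]; ring
            _ ≤ _ := h3
            _ = _ := by ring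
      simp only [← mul_assoc, ← pow_succ'] at h2
      rw [pow_succ']
      exact h2
  intro x η ζ h
  have h2 := abs_expSubOne_le (finiteStep c F) (a := t * totalRate c F)
    (r := 1 + κ / totalRate c F) (β := b x) (by positivity)
    (ContinuousMap.evalCLM ℝ η - ContinuousMap.evalCLM ℝ ζ) f fun n => h1 n x η ζ h
  have e : (t : ℝ) * totalRate c F * (1 + κ / totalRate c F - 1) = κ * t := by
    field_simp
    ring
  rw [e] at h2
  exact h2

/-! ### The full dynamics: the series for the generator and the limiting semigroup. -/

theorem tsum_ofReal_rate_le (c : Rates W S) {b : S → ℝ} (hb : ∀ x, 0 ≤ b x) :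
    ∑' Λ : Finset S, ENNReal.ofReal (rate c Λ * ∑ y ∈ Λ, b y) ≤
      (⨆ x : S, ∑' Λ : {Λ : Finset S // x ∈ Λ}, maxRate c Λ) * ∑' x, ENNReal.ofReal (b x) := by
  refine le_trans (le_of_eq (tsum_congr fun Λ => ?_))
    (tsum_mul_sum_le (fun y => le_iSup (fun x : S => ∑' Λ : {Λ : Finset S // x ∈ Λ},
      maxRate c Λ) y) fun x => ENNReal.ofReal (b x))
  rw [ENNReal.ofReal_mul (rate c Λ).coe_nonneg, ENNReal.ofReal_coe_nnreal, coe_rate,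
    ENNReal.ofReal_sum_of_nonneg fun y _ => hb y]

theorem summable_rate (c : Rates W S)
    (h_rate : (⨆ x : S, ∑' Λ : {Λ : Finset S // x ∈ Λ}, maxRate c Λ) < ⊤) {b : S → ℝ}
    (hb : ∀ x, 0 ≤ b x) (hb' : ∑' x, ENNReal.ofReal (b x) < ⊤) :
    Summable fun Λ : Finset S => rate c Λ * ∑ y ∈ Λ, b y := by
  have h := ENNReal.summable_toReal
    ((tsum_ofReal_rate_le c hb).trans_lt (ENNReal.mul_lt_top h_rate hb')).ne
  refine h.congr fun Λ => ?_
  exact ENNReal.toReal_ofReal (mul_nonneg (rate c Λ).2 (Finset.sum_nonneg fun y _ => hb y))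

/-- `∑_Λ ∫ c_Λ(·, dζ) [f(·^ζ) - f(·)]`, as a series in `C(E)`. -/
noncomputable def jumpSum (c : Rates W S) (f : C(S → W, ℝ)) : C(S → W, ℝ) :=
  ∑' Λ, jump c Λ f

theorem tsum_ofReal_variation (f : C(S → W, ℝ)) :
    ∑' x, ENNReal.ofReal (variation f x).toReal = tripleNorm f :=
  tsum_congr fun x => ENNReal.ofReal_toReal
    ((variation_le_norm f x).trans_lt ENNReal.ofReal_lt_top).ne

variable {c : Rates W S}

theorem hasSum_jump
    (h_rate : (⨆ x : S, ∑' Λ : {Λ : Finset S // x ∈ Λ}, maxRate c Λ) < ⊤) (f : TestSpace W S) :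
    HasSum (fun Λ => jump c Λ (TestSpace.incl W S f)) (jumpSum c (TestSpace.incl W S f)) := by
  have h := summable_rate c h_rate
    (b := fun x => (variation (TestSpace.incl W S f) x).toReal)
    (fun x => ENNReal.toReal_nonneg)
    ((tsum_ofReal_variation _).trans_lt (TestSpace.tripleNorm_lt_top f))
  exact (Summable.of_norm_bounded h fun Λ =>
    norm_jump_le c Λ (varBound_variation _) fun x => ENNReal.toReal_nonneg).hasSum

/-- The constant arises from exchanging the sums over `Λ` and over `y ∈ Λ`. Continuity of `A` on `D`
and the bound on `H` both come from here. -/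
theorem norm_jumpSum_le
    (h_rate : (⨆ x : S, ∑' Λ : {Λ : Finset S // x ∈ Λ}, maxRate c Λ) < ⊤) (f : TestSpace W S) :
    ‖jumpSum c (TestSpace.incl W S f)‖ ≤
      (⨆ x : S, ∑' Λ : {Λ : Finset S // x ∈ Λ}, maxRate c Λ).toReal *
        (tripleNorm (TestSpace.incl W S f)).toReal := by
  let b : S → ℝ := fun x => (variation (TestSpace.incl W S f) x).toReal
  have hb : ∀ x, 0 ≤ b x := fun x => ENNReal.toReal_nonneg
  have e : ∑' x, ENNReal.ofReal (b x) = tripleNorm (TestSpace.incl W S f) :=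
    tsum_ofReal_variation _
  have hw := summable_rate c h_rate hb (e.trans_lt (TestSpace.tripleNorm_lt_top f))
  have hw0 : ∀ Λ : Finset S, 0 ≤ rate c Λ * ∑ y ∈ Λ, b y := fun Λ =>
    mul_nonneg (rate c Λ).2 (Finset.sum_nonneg fun y _ => hb y)
  have h1 : ‖jumpSum c (TestSpace.incl W S f)‖ ≤ ∑' Λ : Finset S, rate c Λ * ∑ y ∈ Λ, b y :=
    tsum_of_norm_bounded hw.hasSum fun Λ => norm_jump_le c Λ (varBound_variation _) hb
  have h2 := tsum_ofReal_rate_le c hb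
  rw [e, ← ENNReal.ofReal_tsum_of_nonneg hw0 hw] at h2
  rw [← ENNReal.toReal_mul]
  refine h1.trans ((ENNReal.ofReal_le_iff_le_toReal ?_).1 h2)
  exact ENNReal.mul_ne_top h_rate.ne (TestSpace.tripleNorm_lt_top f).ne

variable (c) in
/-- Bounds on the variations of a test function that the dynamics controls uniformly. -/
theorem exists_majorant
    (h_rate : (⨆ x : S, ∑' Λ : {Λ : Finset S // x ∈ Λ}, maxRate c Λ) < ⊤)
    (h_dependence : (⨆ x : S, ∑' Λ : {Λ : Finset S // x ∈ Λ}, ∑' u : {u : S // u ≠ x},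
      rateDependence c Λ u) < ⊤) :
    ∃ κ : ℝ, 0 ≤ κ ∧ ∀ f : TestSpace W S, ∃ b : S → ℝ, (∀ x, 0 ≤ b x) ∧
      VarBound (TestSpace.incl W S f) b ∧
      ∑' x, ENNReal.ofReal (b x) ≤ 2 * tripleNorm (TestSpace.incl W S f) ∧
      ∀ (F : Finset (Finset S)) (x : S),
        ∑ Λ ∈ F, (rateDependence c Λ x).toReal * ∑ y ∈ Λ, b y ≤ κ * b x := by
  have hC := (ENNReal.add_lt_top.2
    ⟨ENNReal.mul_lt_top (show (2 : ℝ≥0∞) < ⊤ by simp) h_rate, h_dependence⟩).ne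
  set C := 2 * (⨆ x : S, ∑' Λ : {Λ : Finset S // x ∈ Λ}, maxRate c Λ) +
    ⨆ x : S, ∑' Λ : {Λ : Finset S // x ∈ Λ}, ∑' u : {u : S // u ≠ x}, rateDependence c Λ u
  refine ⟨(2 * C + 1).toReal, ENNReal.toReal_nonneg, fun f => ?_⟩
  obtain ⟨b, hab, hb, hκ⟩ := exists_superharmonic hC (tsum_rateDependence_le c)
    (variation (TestSpace.incl W S f))
  have hbt : ∀ x, b x ≠ ⊤ := fun x => by
    refine ((ENNReal.le_tsum x).trans_lt (hb.trans_lt ?_)).ne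
    exact ENNReal.mul_lt_top (by simp) (TestSpace.tripleNorm_lt_top f)
  refine ⟨fun x => (b x).toReal, fun x => ENNReal.toReal_nonneg, fun x η ζ h => ?_, ?_,
    fun F x => ?_⟩
  · rw [← ENNReal.ofReal_le_iff_le_toReal (hbt x)]
    exact (le_variation _ h).trans (hab x)
  · rw [tsum_congr fun x => ENNReal.ofReal_toReal (hbt x)]
    exact hb
  · rw [← ENNReal.toReal_mul]
    have h1 : ∑ Λ ∈ F, (rateDependence c Λ x).toReal * ∑ y ∈ Λ, (b y).toReal =
        (∑ Λ ∈ F, rateDependence c Λ x * ∑ y ∈ Λ, b y).toReal := by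
      rw [ENNReal.toReal_sum fun Λ _ => ENNReal.mul_ne_top (rateDependence_lt_top c Λ x).ne
        (ENNReal.sum_ne_top.2 fun y _ => hbt y)]
      refine Finset.sum_congr rfl fun Λ _ => ?_
      rw [ENNReal.toReal_mul, ENNReal.toReal_sum fun y _ => hbt y]
    rw [h1]
    refine ENNReal.toReal_mono (ENNReal.mul_ne_top (by finiteness) (hbt x)) ?_
    exact (ENNReal.sum_le_tsum F).trans (hκ x)

variable (c) in
/-- Existence of the semigroup of an interacting particle system. -/
theorem exists_semigroup
    (h_rate : (⨆ x : S, ∑' Λ : {Λ : Finset S // x ∈ Λ}, maxRate c Λ) < ⊤)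
    (h_dependence : (⨆ x : S, ∑' Λ : {Λ : Finset S // x ∈ Λ}, ∑' u : {u : S // u ≠ x},
      rateDependence c Λ u) < ⊤) :
    ∃ (T : MarkovSemigroup (S → W)) (κ : ℝ), 0 ≤ κ ∧ ∀ f : TestSpace W S,
      T.HasGenerator (TestSpace.incl W S f) (jumpSum c (TestSpace.incl W S f)) ∧
      ∃ b : S → ℝ, (∀ x, 0 ≤ b x) ∧
        ∑' x, ENNReal.ofReal (b x) ≤ 2 * tripleNorm (TestSpace.incl W S f) ∧
        ∀ t, VarBound (T.op t (TestSpace.incl W S f)) fun x => Real.exp (κ * t) * b x := by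
  classical
  obtain ⟨κ, hκ0, hmaj⟩ := exists_majorant c h_rate h_dependence
  have hCauchy : ∀ f ∈ range (TestSpace.incl W S), ∀ t₀ : ℝ≥0,
      UniformCauchySeqOn (fun F t => (finiteSemigroup c F).op t f) atTop (Iic t₀) := by
    rintro _ ⟨f, rfl⟩ t₀
    obtain ⟨b, hb0, hfb, hb, hκ⟩ := hmaj f
    have hbt : ∑' x, ENNReal.ofReal (b x) < ⊤ :=
      hb.trans_lt (ENNReal.mul_lt_top (by simp) (TestSpace.tripleNorm_lt_top f))
    have hw := summable_rate c h_rate hb0 hbt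
    intro V hV
    obtain ⟨ε, hε, hεV⟩ := Metric.mem_uniformity_dist.1 hV
    let M : ℝ := Real.exp (κ * t₀)
    have hM : 0 < M := Real.exp_pos _
    -- Two tails below `δ`, amplified by `M` and integrated over a time at most `t₀`, stay below
    -- `ε`; `t₀ + 1` makes this strict and avoids division by zero.
    let δ : ℝ := ε / (2 * (M * (t₀ + 1)))
    have hδ : 0 < δ := by positivity
    obtain ⟨F₀, hF₀⟩ := summable_iff_vanishing_norm.1 hw δ hδ
    have key : ∀ F F' : Finset (Finset S), F₀ ⊆ F → F₀ ⊆ F' → ∀ t ≤ t₀,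
        dist ((finiteSemigroup c F').op t (TestSpace.incl W S f))
          ((finiteSemigroup c F).op t (TestSpace.incl W S f)) < ε := by
      intro F F' hF hF' t ht
      have h1 := MarkovSemigroup.norm_op_sub_op_le (T := finiteSemigroup c F)
        (T' := finiteSemigroup c F') (f := TestSpace.incl W S f) (t := t) (ε := M * (2 * δ))
        fun s hs => ⟨_, _, hasGenerator_finiteSemigroup c F _,
          hasGenerator_finiteSemigroup c F' _, ?_⟩
      · rw [dist_eq_norm]
        refine h1.trans_lt ?_
        have ht' : (t : ℝ) ≤ t₀ := ht
        calc M * (2 * δ) * t ≤ M * (2 * δ) * t₀ := by gcongr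
          _ < M * (2 * δ) * (t₀ + 1) := by
              apply mul_lt_mul_of_pos_left (lt_add_one _); positivity
          _ = ε := by simp only [δ]; field_simp
      -- The variation bound at time `s` does not depend on `F'`, so a tail of one fixed convergent
      -- series controls the difference of the generators.
      · have hv : VarBound ((finiteSemigroup c F').op s (TestSpace.incl W S f))
            fun x => M * b x := fun x η ζ h =>
          (varBound_finiteSemigroup c F' hκ0 hfb hb0 (hκ F') s x η ζ h).trans
            (mul_le_mul_of_nonneg_right (Real.exp_le_exp.2
              (mul_le_mul_of_nonneg_left (hs.trans ht) hκ0)) (hb0 x))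
        have hsum : ∀ G : Finset (Finset S), Disjoint G F₀ →
            ‖∑ Λ ∈ G, jump c Λ ((finiteSemigroup c F').op s (TestSpace.incl W S f))‖ ≤
              M * δ := by
          intro G hG
          calc _ ≤ ∑ Λ ∈ G, rate c Λ * ∑ y ∈ Λ, M * b y :=
                norm_sum_le_of_le _ fun Λ _ =>
                  norm_jump_le c Λ hv fun x => mul_nonneg hM.le (hb0 x)
            _ = M * ∑ Λ ∈ G, rate c Λ * ∑ y ∈ Λ, b y := by
                rw [Finset.mul_sum]
                exact Finset.sum_congr rfl fun Λ _ => by rw [← Finset.mul_sum]; ring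
            _ ≤ M * δ := by
                gcongr
                exact (le_abs_self _).trans (hF₀ G hG).le
        -- Terms common to `F` and `F'` cancel; both remaining index sets are disjoint from `F₀`.
        rw [← Finset.sum_sdiff_sub_sum_sdiff]
        refine (norm_sub_le _ _).trans ?_
        have h2 := hsum (F' \ F) (Finset.sdiff_disjoint.mono_right hF)
        have h3 := hsum (F \ F') (Finset.sdiff_disjoint.mono_right hF')
        linarith
    have hev : ∀ᶠ F : Finset (Finset S) in atTop, F₀ ⊆ F := eventually_ge_atTop F₀
    filter_upwards [hev.prod_mk hev] with p hp t ht
    exact hεV (key p.2 p.1 hp.2 hp.1 t ht)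
  obtain ⟨T, hT⟩ := MarkovSemigroup.exists_tendstoUniformlyOn (finiteSemigroup c)
    denseRange_incl hCauchy
  have hT' : ∀ f t, Tendsto (fun F => (finiteSemigroup c F).op t f) atTop (𝓝 (T.op t f)) :=
    fun f t => (hT f t).tendsto_at (mem_Iic.2 le_rfl)
  refine ⟨T, κ, hκ0, fun f => ⟨?_, ?_⟩⟩
  · exact MarkovSemigroup.HasGenerator.of_tendsto
      (fun F => hasGenerator_finiteSemigroup c F (TestSpace.incl W S f)) tendsto_const_nhds
      (hasSum_jump h_rate f) (hT' _) (hT _)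
  · obtain ⟨b, hb0, hfb, hb, hκ⟩ := hmaj f
    exact ⟨b, hb0, hb, fun t => VarBound.of_tendsto (hT' _ t) fun F =>
      varBound_finiteSemigroup c F hκ0 hfb hb0 (hκ F) t⟩

end Rates

end IPS

/-! ### Exponential, logarithm, and the action of `S(t)` and `V(t)` on `D`. -/

theorem exists_lipschitzOnWith_of_contDiffOn {φ : ℝ → ℝ} {U K : Set ℝ} (hU : IsOpen U)
    (hφ : ContDiffOn ℝ 1 φ U) (hK : IsCompact K) (hKU : K ⊆ U) :
    ∃ L : ℝ≥0, LipschitzOnWith L φ K := by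
  refine LocallyLipschitzOn.exists_lipschitzOnWith_of_compact hK fun x hx => ?_
  obtain ⟨L, t, ht, hL⟩ := ((hφ x (hKU hx)).contDiffAt
    (hU.mem_nhds (hKU hx))).exists_lipschitzOnWith
  exact ⟨L, t, mem_nhdsWithin_of_mem_nhds ht, hL⟩

theorem lipschitzOnWith_exp (R : ℝ) :
    LipschitzOnWith (Real.exp R).toNNReal Real.exp (Iic R) := by
  refine (convex_Iic R).lipschitzOnWith_of_nnnorm_deriv_le
    (fun x _ => Real.differentiableAt_exp) fun x hx => ?_
  rw [Real.deriv_exp, ← NNReal.coe_le_coe, coe_nnnorm, Real.norm_of_nonneg (Real.exp_pos x).le,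
    Real.coe_toNNReal _ (Real.exp_pos R).le]
  exact Real.exp_le_exp.2 hx

theorem expFun_apply {E : Type*} [TopologicalSpace E] (f : C(E, ℝ)) (x : E) :
    expFun f x = Real.exp (f x) := rfl

theorem norm_expFun_le {E : Type*} [TopologicalSpace E] [CompactSpace E] (f : C(E, ℝ)) :
    ‖expFun f‖ ≤ Real.exp ‖f‖ :=
  (ContinuousMap.norm_le _ (Real.exp_pos _).le).2 fun x => by
    rw [expFun_apply, Real.norm_of_nonneg (Real.exp_pos _).le]
    exact Real.exp_le_exp.2 ((le_abs_self _).trans (f.norm_coe_le_norm x))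

theorem MarkovSemigroup.isClosed_generator {E : Type*} [TopologicalSpace E] [CompactSpace E]
    (T : MarkovSemigroup E) : T.generator.IsClosed := by
  have : (T.generator.graph : Set (C(E, ℝ) × C(E, ℝ))) = {p | T.HasGenerator p.1 p.2} :=
    Set.ext fun p => MarkovSemigroup.mem_graph_generator
  rw [LinearPMap.IsClosed, this]
  exact T.isClosed_hasGenerator

theorem MarkovSemigroup.op_expFun_mem_Icc {E : Type*} [TopologicalSpace E] [CompactSpace E]
    (T : MarkovSemigroup E) (t : ℝ≥0) {f : C(E, ℝ)} {R : ℝ} (hf : ‖f‖ ≤ R) (x : E) :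
    T.op t (expFun f) x ∈ Icc (Real.exp (-R)) (Real.exp R) := by
  have h1 : Real.exp (-R) • (1 : C(E, ℝ)) ≤ expFun f := fun y => by
    have := (neg_le_abs _).trans ((f.norm_coe_le_norm y).trans hf)
    change Real.exp (-R) * 1 ≤ Real.exp (f y)
    rw [mul_one]
    exact Real.exp_le_exp.2 (by linarith)
  have h2 : expFun f ≤ Real.exp R • (1 : C(E, ℝ)) := fun y => by
    have := (le_abs_self _).trans ((f.norm_coe_le_norm y).trans hf)
    change Real.exp (f y) ≤ Real.exp R * 1
    rw [mul_one]
    exact Real.exp_le_exp.2 this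
  have h3 := T.op_mono t h1
  have h4 := T.op_mono t h2
  rw [map_smul, T.op_one] at h3 h4
  have h5 := h3 x
  have h6 := h4 x
  change Real.exp (-R) * 1 ≤ T.op t (expFun f) x at h5
  change T.op t (expFun f) x ≤ Real.exp R * 1 at h6
  rw [mul_one] at h5 h6
  exact ⟨h5, h6⟩

namespace IPS

namespace TestSpace

variable {W S : Type*} [TopologicalSpace W] [CompactSpace W]

theorem exists_exp : ∃ F : TestSpace W S → TestSpace W S,
    (∀ f, incl W S (F f) = expFun (incl W S f)) ∧ Continuous F := by
  have h : ∀ f : TestSpace W S, ∃ g : TestSpace W S, ∀ η,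
      incl W S g η = Real.exp (incl W S f η) := fun f =>
    exists_comp f ((lipschitzOnWith_exp ‖incl W S f‖).mono (by
      rintro _ ⟨η, rfl⟩
      exact (le_abs_self _).trans ((incl W S f).norm_coe_le_norm η)))
  choose F hF using h
  refine ⟨F, fun f => ContinuousMap.ext (hF f), continuous_iff_continuousAt.2 fun f => ?_⟩
  have h1 : ∀ᶠ g in 𝓝 f, ‖incl W S g‖ < ‖incl W S f‖ + 1 :=
    (continuous_incl.norm.tendsto f).eventually (gt_mem_nhds (lt_add_one _))
  refine tendsto_comp (lipschitzOnWith_exp (‖incl W S f‖ + 1)) tendsto_id ?_ ?_ hF (hF f)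
  · filter_upwards [h1] with g hg η
    exact (le_abs_self _).trans (((incl W S g).norm_coe_le_norm η).trans hg.le)
  · intro η
    exact (le_abs_self _).trans
      (((incl W S f).norm_coe_le_norm η).trans (lt_add_one _).le)

theorem toReal_tripleNorm_exp_le {f g : TestSpace W S} (h : incl W S g = expFun (incl W S f)) :
    (tripleNorm (incl W S g)).toReal ≤
      Real.exp ‖incl W S f‖ * (tripleNorm (incl W S f)).toReal := by
  have h1 : tripleNorm (incl W S g) ≤
      (Real.exp ‖incl W S f‖).toNNReal * tripleNorm (incl W S f) := by
    rw [tripleNorm, tripleNorm, ← ENNReal.tsum_mul_left]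
    refine ENNReal.tsum_le_tsum fun x => variation_comp_le (lipschitzOnWith_exp ‖incl W S f‖)
      (fun η => (le_abs_self _).trans ((incl W S f).norm_coe_le_norm η)) (fun η => ?_) x
    rw [h, expFun_apply]
  have h2 := ENNReal.toReal_mono
    (ENNReal.mul_ne_top ENNReal.coe_ne_top (tripleNorm_lt_top f).ne) h1
  rwa [ENNReal.toReal_mul, ENNReal.coe_toReal, Real.coe_toNNReal _ (Real.exp_pos _).le] at h2

/-- The constant function `1`, as an element of `D`. -/
theorem exists_one : ∃ g : TestSpace W S, incl W S g = 1 :=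
  ⟨ofFinite 1 (by simp [tripleNorm, variation]), rfl⟩

section Semigroup

variable {T : MarkovSemigroup (S → W)} {κ : ℝ}

/-- At fixed `t` the map is linear and bounded. Near `t₀` the majorant `e^{κ (t₀ + 1)} b` dominates
all variations, which upgrades sup norm continuity in time to continuity in `D`. -/
theorem exists_semigroup (hκ : 0 ≤ κ)
    (h : ∀ f : TestSpace W S, ∃ b : S → ℝ, (∀ x, 0 ≤ b x) ∧
      ∑' x, ENNReal.ofReal (b x) ≤ 2 * tripleNorm (incl W S f) ∧
      ∀ t, VarBound (T.op t (incl W S f)) fun x => Real.exp (κ * t) * b x) :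
    ∃ F : ℝ≥0 → TestSpace W S → TestSpace W S,
      (∀ t f, incl W S (F t f) = T.op t (incl W S f)) ∧
      (∀ t, Continuous (F t)) ∧ ∀ f, Continuous fun t => F t f := by
  have h1 : ∀ t f, tripleNorm (T.op t (incl W S f)) ≤
      ENNReal.ofReal (Real.exp (κ * t)) * (2 * tripleNorm (incl W S f)) := by
    intro t f
    obtain ⟨b, hb0, hb, hfb⟩ := h f
    refine le_trans ?_ (mul_le_mul_right hb _)
    rw [← ENNReal.tsum_mul_left]
    refine ENNReal.tsum_le_tsum fun x => ((hfb t).variation_le x).trans ?_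
    rw [ENNReal.ofReal_mul (Real.exp_pos _).le]
  have hfin : ∀ t f, ENNReal.ofReal (Real.exp (κ * t)) * (2 * tripleNorm (incl W S f)) < ⊤ :=
    fun t f => ENNReal.mul_lt_top ENNReal.ofReal_lt_top
      (ENNReal.mul_lt_top (by simp) (tripleNorm_lt_top f))
  let F (t : ℝ≥0) : TestSpace W S →ₗ[ℝ] TestSpace W S :=
    { toFun := fun f => ofFinite (T.op t (incl W S f)) ((h1 t f).trans_lt (hfin t f))
      map_add' := fun f g => incl_injective (by simp)
      map_smul' := fun a f => incl_injective (by simp) }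
  have hF : ∀ t f, incl W S (F t f) = T.op t (incl W S f) := fun t f => rfl
  refine ⟨fun t => F t, hF, fun t => ?_, fun f => continuous_iff_continuousAt.2 fun t₀ => ?_⟩
  · refine ((F t).mkContinuous (Real.exp (κ * t) * 2 + 1) fun f => ?_).continuous
    have h2 := ENNReal.toReal_mono (hfin t f).ne (h1 t f)
    rw [ENNReal.toReal_mul, ENNReal.toReal_mul, ENNReal.toReal_ofReal (Real.exp_pos _).le,
      ENNReal.toReal_ofNat, ← hF] at h2
    have h3 : ‖incl W S (F t f)‖ ≤ ‖incl W S f‖ := T.norm_op_le t _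
    have h4 := toReal_tripleNorm_le f
    have h5 := norm_incl_le f
    rw [norm_def (F t f)]
    have h6 : Real.exp (κ * t) * (2 * (tripleNorm (incl W S f)).toReal) ≤
        Real.exp (κ * t) * (2 * ‖f‖) := by gcongr
    linarith
  · obtain ⟨b, hb0, hb, hfb⟩ := h f
    refine tendsto_of_dominated
      (a := fun x => ENNReal.ofReal (Real.exp (κ * (t₀ + 1)) * b x)) (b := fun _ _ => 0)
      ((T.continuous_op (incl W S f)).tendsto t₀) ?_ ?_ (by simp)
    · filter_upwards [Iic_mem_nhds (lt_add_one t₀)] with t ht x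
      rw [add_zero, hF]
      refine ((hfb t).variation_le x).trans (ENNReal.ofReal_le_ofReal ?_)
      have ht' : (t : ℝ) ≤ t₀ + 1 := by exact_mod_cast ht
      exact mul_le_mul_of_nonneg_right
        (Real.exp_le_exp.2 (mul_le_mul_of_nonneg_left ht' hκ)) (hb0 x)
    · simp_rw [ENNReal.ofReal_mul (Real.exp_pos _).le, ENNReal.tsum_mul_left]
      refine (ENNReal.mul_lt_top ENNReal.ofReal_lt_top (hb.trans_lt ?_)).ne
      exact ENNReal.mul_lt_top (by simp) (tripleNorm_lt_top f)

/-- For `‖f‖ ≤ R` the function `S(t) e^f` stays in `[e^{-R}, e^R]`, away from `0`, where `log` is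
Lipschitz. So `V(t)` is a composition of continuous maps; continuity in `f` takes `R = ‖f‖ + 1` to
cover a neighbourhood. -/
theorem exists_log_semigroup {F : ℝ≥0 → TestSpace W S → TestSpace W S}
    (hF : ∀ t f, incl W S (F t f) = T.op t (incl W S f)) (hFc : ∀ t, Continuous (F t))
    (hFt : ∀ f, Continuous fun t => F t f) :
    ∃ G : ℝ≥0 → TestSpace W S → TestSpace W S,
      (∀ t f x, incl W S (G t f) x = Real.log (T.op t (expFun (incl W S f)) x)) ∧
      (∀ t, Continuous (G t)) ∧ ∀ f, Continuous fun t => G t f := by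
  obtain ⟨E, hE, hEc⟩ := exists_exp (W := W) (S := S)
  have hlog : ∀ R : ℝ, ∃ L : ℝ≥0,
      LipschitzOnWith L Real.log (Icc (Real.exp (-R)) (Real.exp R)) := fun R =>
    exists_lipschitzOnWith_of_contDiffOn (isOpen_Ioi (a := (0 : ℝ)))
      (Real.contDiffOn_log.mono fun x hx => (ne_of_gt hx : x ≠ 0)) isCompact_Icc
      fun x hx => (Real.exp_pos _).trans_le hx.1
  have hFE : ∀ t f, incl W S (F t (E f)) = T.op t (expFun (incl W S f)) := fun t f => by
    rw [hF, hE]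
  have hmem : ∀ t f R, ‖incl W S f‖ ≤ R → ∀ η,
      incl W S (F t (E f)) η ∈ Icc (Real.exp (-R)) (Real.exp R) := fun t f R hR η => by
    rw [hFE]; exact T.op_expFun_mem_Icc t hR η
  have hex : ∀ t f, ∃ g : TestSpace W S, ∀ η,
      incl W S g η = Real.log (incl W S (F t (E f)) η) := fun t f => by
    obtain ⟨L, hL⟩ := hlog ‖incl W S f‖
    refine exists_comp (F t (E f)) (hL.mono ?_)
    rintro _ ⟨η, rfl⟩
    exact hmem t f _ le_rfl η
  choose G hG using hex
  refine ⟨G, fun t f x => by rw [hG, hFE], fun t => continuous_iff_continuousAt.2 fun f => ?_,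
    fun f => continuous_iff_continuousAt.2 fun t => ?_⟩
  · obtain ⟨L, hL⟩ := hlog (‖incl W S f‖ + 1)
    have h1 : ∀ᶠ g in 𝓝 f, ‖incl W S g‖ < ‖incl W S f‖ + 1 :=
      (continuous_incl.norm.tendsto f).eventually (gt_mem_nhds (lt_add_one _))
    exact tendsto_comp hL (((hFc t).comp hEc).tendsto f)
      (h1.mono fun g hg => hmem t g _ hg.le) (hmem t f _ (lt_add_one _).le) (hG t) (hG t f)
  · obtain ⟨L, hL⟩ := hlog ‖incl W S f‖
    exact tendsto_comp hL ((hFt (E f)).tendsto t)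
      (.of_forall fun s => hmem s f _ le_rfl) (hmem t f _ le_rfl) (fun s => hG s f) (hG t f)

end Semigroup

end TestSpace

/-! ### The generator as a closure, and the two sets of conditions. -/

section Generator

variable {W S : Type*} [MetricSpace W] [CompactSpace W] [MeasurableSpace W] [BorelSpace W]
  {c : Rates W S}

theorem hasFormalGenerator_jumpSum
    (h_rate : (⨆ x : S, ∑' Λ : {Λ : Finset S // x ∈ Λ}, maxRate c Λ) < ⊤) (f : TestSpace W S) :
    HasFormalGenerator c (TestSpace.incl W S f) (jumpSum c (TestSpace.incl W S f)) := fun η =>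
  (hasSum_jump h_rate f).mapL (ContinuousMap.evalCLM ℝ η)

theorem mem_graph_formalGenerator {p : C(S → W, ℝ) × C(S → W, ℝ)} :
    p ∈ (formalGenerator c).graph ↔ p.1 ∈ testFunctions W S ∧ HasFormalGenerator c p.1 p.2 := by
  rw [LinearPMap.mem_graph_iff]
  constructor
  · rintro ⟨y, hy, hy'⟩
    rw [← hy, ← hy']
    exact ⟨y.2.1, Classical.choose_spec y.2.2⟩
  · rintro ⟨h1, h2⟩
    exact ⟨⟨p.1, h1, p.2, h2⟩, rfl, (Classical.choose_spec (⟨p.2, h2⟩ : ∃ g, _)).unique h2⟩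

theorem domain_formalGenerator
    (h_rate : (⨆ x : S, ∑' Λ : {Λ : Finset S // x ∈ Λ}, maxRate c Λ) < ⊤) :
    (formalGenerator c).domain = testFunctions W S :=
  le_antisymm (fun _ hf => hf.1) fun f hf =>
    ⟨hf, _, hasFormalGenerator_jumpSum h_rate (⟨f, hf⟩ : TestSpace W S)⟩

variable {T : MarkovSemigroup (S → W)}

theorem graph_formalGenerator_le
    (h_rate : (⨆ x : S, ∑' Λ : {Λ : Finset S // x ∈ Λ}, maxRate c Λ) < ⊤)
    (hT : ∀ f : TestSpace W S,
      T.HasGenerator (TestSpace.incl W S f) (jumpSum c (TestSpace.incl W S f))) :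
    (formalGenerator c).graph ≤ T.generator.graph := by
  intro p hp
  obtain ⟨hp1, hp2⟩ := mem_graph_formalGenerator.1 hp
  rw [MarkovSemigroup.mem_graph_generator]
  have h := hT (⟨p.1, hp1⟩ : TestSpace W S)
  have e : jumpSum c p.1 = p.2 :=
    (hasFormalGenerator_jumpSum h_rate (⟨p.1, hp1⟩ : TestSpace W S)).unique hp2
  rw [← e]
  exact h

theorem isClosable_formalGenerator
    (h_rate : (⨆ x : S, ∑' Λ : {Λ : Finset S // x ∈ Λ}, maxRate c Λ) < ⊤)
    (hT : ∀ f : TestSpace W S,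
      T.HasGenerator (TestSpace.incl W S f) (jumpSum c (TestSpace.incl W S f))) :
    (formalGenerator c).IsClosable :=
  T.isClosed_generator.isClosable.leIsClosable
    (LinearPMap.le_of_le_graph (graph_formalGenerator_le h_rate hT))

/-- The substantial inclusion is that `D` is a core. By invariance `S(t) f ∈ D`, and `A S(t) f =
S(t) A f` by uniqueness, so the orbits of pairs `(f, A f)` stay in the graph of the formal
generator. -/
theorem generator_eq_closure
    (h_rate : (⨆ x : S, ∑' Λ : {Λ : Finset S // x ∈ Λ}, maxRate c Λ) < ⊤)
    (hT : ∀ f : TestSpace W S,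
      T.HasGenerator (TestSpace.incl W S f) (jumpSum c (TestSpace.incl W S f)))
    (hinv : ∀ t (f : TestSpace W S), ∃ g : TestSpace W S,
      TestSpace.incl W S g = T.op t (TestSpace.incl W S f)) :
    T.generator = (formalGenerator c).closure := by
  refine LinearPMap.eq_of_eq_graph (le_antisymm ?_ ?_)
  · rw [← (isClosable_formalGenerator h_rate hT).graph_closure_eq_closure_graph]
    intro p hp
    refine MarkovSemigroup.HasGenerator.mem_of_core (T := T)
      (Submodule.isClosed_topologicalClosure _) denseRange_incl ?_
      (MarkovSemigroup.mem_graph_generator.1 hp)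
    rintro _ ⟨f, rfl⟩
    refine ⟨_, hT f, fun t => Submodule.le_topologicalClosure _ ?_⟩
    obtain ⟨g, hg⟩ := hinv t f
    have h1 := hT g
    rw [hg] at h1
    rw [← h1.unique ((hT f).op t), ← hg]
    exact mem_graph_formalGenerator.2 ⟨g.2, hasFormalGenerator_jumpSum h_rate g⟩
  · rw [← (isClosable_formalGenerator h_rate hT).graph_closure_eq_closure_graph]
    exact Submodule.topologicalClosure_minimal _ (graph_formalGenerator_le h_rate hT)
      T.isClosed_generator

theorem algebraCoreCondition
    (h_rate : (⨆ x : S, ∑' Λ : {Λ : Finset S // x ∈ Λ}, maxRate c Λ) < ⊤)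
    (hT : ∀ f : TestSpace W S,
      T.HasGenerator (TestSpace.incl W S f) (jumpSum c (TestSpace.incl W S f)))
    (hcl : T.generator = (formalGenerator c).closure) :
    AlgebraCoreCondition T (TestSpace.incl W S) where
  injective := TestSpace.incl_injective
  le_domain f := ⟨_, hT f⟩
  core f := by
    have hgr : T.generator.graph = (formalGenerator c).graph.topologicalClosure := by
      rw [hcl, (isClosable_formalGenerator h_rate hT).graph_closure_eq_closure_graph]
    have h1 : ((f : C(S → W, ℝ)), T.generator f) ∈ (formalGenerator c).graph.topologicalClosure :=
      hgr ▸ T.generator.mem_graph f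
    obtain ⟨u, hu, hlim⟩ := mem_closure_iff_seq_limit.1 h1
    have hu' := fun n => mem_graph_formalGenerator.1 (hu n)
    refine ⟨fun n => (⟨(u n).1, (hu' n).1⟩ : TestSpace W S),
      (continuous_fst.tendsto _).comp hlim, ?_⟩
    have h2 : Tendsto (fun n => (u n).2) atTop (𝓝 (T.generator f)) :=
      (continuous_snd.tendsto _).comp hlim
    refine h2.congr fun n => ?_
    symm
    exact MarkovSemigroup.HasGenerator.generator_eq
      (MarkovSemigroup.mem_graph_generator.1 (graph_formalGenerator_le h_rate hT (hu n))) _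
  dense := denseRange_incl
  mul_mem f g := by
    obtain ⟨F, hF, -⟩ := TestSpace.exists_mul (W := W) (S := S)
    exact ⟨F (f, g), hF (f, g)⟩
  smooth_comp_mem f φ U hU hfU hφ := by
    obtain ⟨L, hL⟩ := exists_lipschitzOnWith_of_contDiffOn hU (hφ.of_le (by norm_cast))
      (isCompact_range (TestSpace.incl W S f).continuous) hfU
    exact TestSpace.exists_comp f hL

/-- `‖H f‖ ≤ ‖e^{-f}‖ K |||e^f|||` and `|||e^f||| ≤ e^{‖f‖} |||f|||`; each exponential contributes
at most `e^R`. -/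
theorem norm_hamiltonian_le
    (h_rate : (⨆ x : S, ∑' Λ : {Λ : Finset S // x ∈ Λ}, maxRate c Λ) < ⊤)
    (hT : ∀ f : TestSpace W S,
      T.HasGenerator (TestSpace.incl W S f) (jumpSum c (TestSpace.incl W S f)))
    {f : TestSpace W S} {R : ℝ} (hf : ‖f‖ ≤ R)
    (hd : expFun (TestSpace.incl W S f) ∈ T.generator.domain) :
    ‖hamiltonian T.generator (TestSpace.incl W S f) hd‖ ≤
      (⨆ x : S, ∑' Λ : {Λ : Finset S // x ∈ Λ}, maxRate c Λ).toReal *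
        (R * Real.exp (2 * R)) := by
  obtain ⟨E, hE, -⟩ := TestSpace.exists_exp (W := W) (S := S)
  set K := (⨆ x : S, ∑' Λ : {Λ : Finset S // x ∈ Λ}, maxRate c Λ).toReal
  have hK : 0 ≤ K := ENNReal.toReal_nonneg
  have h1 : T.HasGenerator (expFun (TestSpace.incl W S f)) (jumpSum c (expFun _)) := hE f ▸ hT (E f)
  have h2 := norm_jumpSum_le h_rate (E f)
  have h3 := TestSpace.toReal_tripleNorm_exp_le (hE f)
  rw [hE] at h2 h3
  have h4 := (TestSpace.norm_incl_le f).trans hf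
  have h5 := (TestSpace.toReal_tripleNorm_le f).trans hf
  have hR : 0 ≤ R := (norm_nonneg _).trans hf
  have h6 : ‖expFun (-TestSpace.incl W S f)‖ ≤ Real.exp R := by
    refine (norm_expFun_le _).trans (Real.exp_le_exp.2 ?_)
    rwa [norm_neg]
  rw [hamiltonian, h1.generator_eq hd]
  calc ‖expFun (-TestSpace.incl W S f) * jumpSum c (expFun (TestSpace.incl W S f))‖
      ≤ ‖expFun (-TestSpace.incl W S f)‖ * ‖jumpSum c (expFun (TestSpace.incl W S f))‖ :=
        norm_mul_le _ _
    _ ≤ Real.exp R * (K * (Real.exp R * R)) := by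
        gcongr
        refine h2.trans (mul_le_mul_of_nonneg_left (h3.trans ?_) hK)
        gcongr
    _ = K * (R * Real.exp (2 * R)) := by
        rw [two_mul, Real.exp_add]; ring

theorem topologicalCoreCondition [Countable S]
    (h_rate : (⨆ x : S, ∑' Λ : {Λ : Finset S // x ∈ Λ}, maxRate c Λ) < ⊤)
    (hT : ∀ f : TestSpace W S,
      T.HasGenerator (TestSpace.incl W S f) (jumpSum c (TestSpace.incl W S f)))
    (hcl : T.generator = (formalGenerator c).closure)
    {F : ℝ≥0 → TestSpace W S → TestSpace W S}
    (hF : ∀ t f, TestSpace.incl W S (F t f) = T.op t (TestSpace.incl W S f))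
    (hFc : ∀ t, Continuous (F t)) (hFt : ∀ f, Continuous fun t => F t f) :
    TopologicalCoreCondition T (TestSpace.incl W S) where
  toAlgebraCoreCondition := algebraCoreCondition h_rate hT hcl
  isTopologicalAddGroup := inferInstance
  continuousSMul := inferInstance
  locallyConvex := inferInstance
  hausdorff := inferInstance
  separable := inferInstance
  barrelled _ hB := hB.mem_nhds_zero
  finer := TestSpace.continuous_incl
  exp_sub_one := by
    obtain ⟨E, hE, hEc⟩ := TestSpace.exists_exp (W := W) (S := S)
    obtain ⟨g, hg⟩ := TestSpace.exists_one (W := W) (S := S)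
    exact ⟨fun f => E f - g, fun f => by rw [map_sub, hE, hg], hEc.sub continuous_const⟩
  mul := TestSpace.exists_mul
  semigroup := ⟨F, hF, hFc, hFt⟩
  log_semigroup := TestSpace.exists_log_semigroup hF hFc hFt
  continuous_generator := by
    let A : TestSpace W S →ₗ[ℝ] C(S → W, ℝ) :=
      T.generator.toFun.comp
        ((TestSpace.incl W S).codRestrict T.generator.domain fun f => ⟨_, hT f⟩)
    refine (A.mkContinuous
      (⨆ x : S, ∑' Λ : {Λ : Finset S // x ∈ Λ}, maxRate c Λ).toReal fun f => ?_).continuous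
    have h1 : A f = jumpSum c (TestSpace.incl W S f) := (hT f).generator_eq _
    rw [h1]
    refine (norm_jumpSum_le h_rate f).trans ?_
    gcongr
    exact TestSpace.toReal_tripleNorm_le f
  exp_mem_domain f := by
    obtain ⟨E, hE, -⟩ := TestSpace.exists_exp (W := W) (S := S)
    exact hE f ▸ ⟨_, hT (E f)⟩
  hamiltonian_bound := by
    set K := (⨆ x : S, ∑' Λ : {Λ : Finset S // x ∈ Λ}, maxRate c Λ).toReal with hKdef
    have hK : 0 ≤ K := ENNReal.toReal_nonneg
    -- As `r ≤ 1`, the bound `K r e^{2r}` is at most `K e² r ≤ 1`.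
    let r : ℝ := (K * Real.exp 2 + 1)⁻¹
    have hr : 0 < r := by positivity
    have hr1 : r ≤ 1 := inv_le_one_of_one_le₀ (by
      have : 0 ≤ K * Real.exp 2 := by positivity
      linarith)
    refine ⟨Metric.closedBall 0 r, isBarrel_closedBall hr, fun f hf => ?_, fun a ha => ?_⟩
    · refine (norm_hamiltonian_le h_rate hT (mem_closedBall_zero_iff.1 hf) _).trans ?_
      calc K * (r * Real.exp (2 * r)) ≤ K * (r * Real.exp 2) := by
            gcongr
            linarith
        _ = (K * Real.exp 2) / (K * Real.exp 2 + 1) := by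
            simp only [r]; rw [div_eq_mul_inv]; ring
        _ ≤ 1 := by
            rw [div_le_one (by positivity)]
            linarith
    · refine ⟨K * (a * r * Real.exp (2 * (a * r))), ?_⟩
      rintro _ ⟨g, hg, rfl⟩
      refine norm_hamiltonian_le h_rate hT ?_ _
      change ‖a • g‖ ≤ a * r
      rw [norm_smul, Real.norm_of_nonneg ha.le]
      exact mul_le_mul_of_nonneg_left (mem_closedBall_zero_iff.1 hg) ha.le

end Generator

end IPS

theorem mainTheorem7 {W S : Type*} [MetricSpace W] [CompactSpace W] [MeasurableSpace W]
    [BorelSpace W] [Countable S] (c : IPS.Rates W S)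
    (h_rate : (⨆ x : S, ∑' Λ : {Λ : Finset S // x ∈ Λ}, IPS.maxRate c Λ) < ⊤)
    (h_dependence : (⨆ x : S, ∑' Λ : {Λ : Finset S // x ∈ Λ}, ∑' u : {u : S // u ≠ x},
      IPS.rateDependence c Λ u) < ⊤) :
    CompleteSpace (IPS.TestSpace W S) ∧
    TopologicalSpace.SeparableSpace (IPS.TestSpace W S) ∧
    (IPS.formalGenerator c).domain = IPS.testFunctions W S ∧
    (IPS.formalGenerator c).IsClosable ∧
    (∃ T : MarkovSemigroup (S → W), T.generator = (IPS.formalGenerator c).closure) ∧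
    ∀ T : MarkovSemigroup (S → W), T.generator = (IPS.formalGenerator c).closure →
      AlgebraCoreCondition T (IPS.TestSpace.incl W S) ∧
      TopologicalCoreCondition T (IPS.TestSpace.incl W S) := by
  obtain ⟨T, κ, hκ, hTκ⟩ := IPS.exists_semigroup c h_rate h_dependence
  have hT := fun f => (hTκ f).1
  obtain ⟨F, hF, hFc, hFt⟩ := IPS.TestSpace.exists_semigroup hκ fun f => (hTκ f).2
  have hcl := IPS.generator_eq_closure h_rate hT fun t f => ⟨F t f, hF t f⟩
  refine ⟨inferInstance, inferInstance, IPS.domain_formalGenerator h_rate,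
    IPS.isClosable_formalGenerator h_rate hT, ⟨T, hcl⟩, fun T' hT' => ?_⟩
  have hd : Dense (T.generator.domain : Set C(S → W, ℝ)) :=
    Dense.mono (by rintro _ ⟨f, rfl⟩; exact ⟨_, hT f⟩) (IPS.denseRange_incl (W := W) (S := S))
  -- The domain contains the dense set `D`, so the closure determines the semigroup and it suffices
  -- to verify the conditions for the constructed one.
  obtain rfl : T = T' := MarkovSemigroup.eq_of_op_eq
    (MarkovSemigroup.op_eq_of_generator_eq (hcl.trans hT'.symm) hd)
  exact ⟨IPS.algebraCoreCondition h_rate hT hcl,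
    IPS.topologicalCoreCondition h_rate hT hcl hF hFc hFt⟩
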